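/- **Theorem.** Let $n\ge 3$ and let $f:(0,\infty)\to(0,\infty)$ be continuous with $$0<\liminf_{s\searrow 0}\, s^{-n/(n-2)}f(s)\le\infty .$$ Let $\Omega\subset\mathbb{R}^n$ be an exterior domain, that is, a connected open set with bounded complement. Then the differential inequality $-\Delta u\ge f(u)$ has no positive solution in $\Omega$, in any of the following senses: 1. (classical) there is no $u\in C^2(\Omega)$ with $u>0$ and $-\Delta u(x)\ge f(u(x))$ for all $x\in\Omega$; 2. (weak Sobolev) there is no $u\in W^{1,2}_{\mathrm{loc}}(\Omega)$ with $u>0$ almost everywhere in $\Omega$ such that, for every nonnegative $\varphi\in C_c^\infty(\Omega)$, the function $f(u)\varphi$ is integrable and $\int_\Omega Du\cdot D\varphi\,dx\ge\int_\Omega f(u)\,\varphi\,dx$; 3. (viscosity) there is no lower semicontinuous $u:\Omega\to(0,\infty)$ such that $-\Delta\varphi(x_0)\ge f(u(x_0))$ whenever $x_0\in\Omega$, $\varphi\in C^2(\Omega)$ and $u-\varphi$ has a local minimum at $x_0$. No condition on $f$ away from $0$, other than continuity and positivity, is assumed. -/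

import Mathlib

open scoped ContDiff Topology InnerProductSpace Gradient

/-- An exterior domain of `ℝⁿ`: an open connected set whose complement is bounded, that is,
which contains the complement of some ball. -/
def IsExteriorDomain {n : ℕ} (Ω : Set (EuclideanSpace ℝ (Fin n))) : Prop :=
  IsOpen Ω ∧ IsConnected Ω ∧ Bornology.IsBounded Ωᶜ

/-- `φ ∈ C_c^∞(Ω)`: smooth with compact support contained in `Ω`. -/
def IsTestFunction {n : ℕ} (Ω : Set (EuclideanSpace ℝ (Fin n)))
    (φ : EuclideanSpace ℝ (Fin n) → ℝ) : Prop :=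
  ContDiff ℝ ∞ φ ∧ HasCompactSupport φ ∧ tsupport φ ⊆ Ω

/-- `w ∈ L²_loc(Ω)`: `w` is square integrable on every compact subset of `Ω`. -/
def MemL2Loc {n : ℕ} {F : Type*} [NormedAddCommGroup F] (Ω : Set (EuclideanSpace ℝ (Fin n)))
    (w : EuclideanSpace ℝ (Fin n) → F) : Prop :=
  ∀ K : Set (EuclideanSpace ℝ (Fin n)), IsCompact K → K ⊆ Ω →
    MeasureTheory.MemLp w 2 (MeasureTheory.volume.restrict K)

/-- `g` is the weak gradient of `u` in `Ω`: `∫ u ∇φ = -∫ φ g` for all `φ ∈ C_c^∞(Ω)`.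
It is used below for `u` and `g` in `L²_loc(Ω)`, where both integrals converge. -/
def IsWeakGradient {n : ℕ} (Ω : Set (EuclideanSpace ℝ (Fin n)))
    (u : EuclideanSpace ℝ (Fin n) → ℝ)
    (g : EuclideanSpace ℝ (Fin n) → EuclideanSpace ℝ (Fin n)) : Prop :=
  ∀ φ : EuclideanSpace ℝ (Fin n) → ℝ, IsTestFunction Ω φ →
    ∫ x in Ω, u x • ∇ φ x = -∫ x in Ω, φ x • g x

/-- `u` is a classical solution of `-Δu ≥ f(u)` in `Ω`: `u ∈ C²(Ω)` and the inequality holds at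
every point of `Ω`. -/
def IsClassicalSupersolution {n : ℕ} (f : ℝ → ℝ) (Ω : Set (EuclideanSpace ℝ (Fin n)))
    (u : EuclideanSpace ℝ (Fin n) → ℝ) : Prop :=
  ContDiffOn ℝ 2 u Ω ∧ ∀ x ∈ Ω, f (u x) ≤ -(Laplacian.laplacian u x)

/-- `u` is a weak (Sobolev) solution of `-Δu ≥ f(u)` in `Ω`: `u ∈ W^{1,2}_loc(Ω)`, with weak
gradient `g`, and `∫ g · ∇φ ≥ ∫ f(u) φ` for all nonnegative `φ ∈ C_c^∞(Ω)`. The right-hand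
integral is required to converge, so that the inequality is between genuine integrals. -/
def IsWeakSupersolution {n : ℕ} (f : ℝ → ℝ) (Ω : Set (EuclideanSpace ℝ (Fin n)))
    (u : EuclideanSpace ℝ (Fin n) → ℝ) : Prop :=
  MemL2Loc Ω u ∧ ∃ g : EuclideanSpace ℝ (Fin n) → EuclideanSpace ℝ (Fin n),
    MemL2Loc Ω g ∧ IsWeakGradient Ω u g ∧
      ∀ φ : EuclideanSpace ℝ (Fin n) → ℝ, IsTestFunction Ω φ → (∀ x, 0 ≤ φ x) →
        MeasureTheory.IntegrableOn (fun x => f (u x) * φ x) Ω ∧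
          ∫ x in Ω, f (u x) * φ x ≤ ∫ x in Ω, ⟪g x, ∇ φ x⟫_ℝ

/-- `u` is a viscosity solution of `-Δu ≥ f(u)` in `Ω`: `u` is lower semicontinuous in `Ω`, and
`-Δφ(x₀) ≥ f(u(x₀))` whenever `φ ∈ C²(Ω)` and `u - φ` has a local minimum at `x₀ ∈ Ω`. -/
def IsViscositySupersolution {n : ℕ} (f : ℝ → ℝ) (Ω : Set (EuclideanSpace ℝ (Fin n)))
    (u : EuclideanSpace ℝ (Fin n) → ℝ) : Prop :=
  LowerSemicontinuousOn u Ω ∧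
    ∀ x₀ ∈ Ω, ∀ φ : EuclideanSpace ℝ (Fin n) → ℝ, ContDiffOn ℝ 2 φ Ω →
      IsLocalMinOn (fun x => u x - φ x) Ω x₀ →
        f (u x₀) ≤ -(Laplacian.laplacian φ x₀)

/-! Write N = n − 2 and p = n/N. Comparison with harmonic functions shows that a positive
supersolution decays no faster than |x|^(−N): u ≥ Y|x|^(−N) far out. Since pN = n, the nonlinearity
then contributes f(u) ≥ cY^p |x|^(−n), and |x|^(−n) is, up to a constant, minus the Laplacian of
|x|^(−N) log|x|. A logarithmic barrier therefore raises the coefficient Y by a multiple of Y^p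
(capped at KY) at the price of a fixed dilation of the radius: `improve_lower_bound`. In the other
direction, a coefficient Y valid beyond radius ρ satisfies Y ≤ Cρ^N, because otherwise harmonic
comparison from the outside would push u above an unattainable level on a fixed shell:
`exists_upper_bound`. Iterating over radii that grow by the factor 2e, the upper bound grows by Λ =
(2e)^N per step while the coefficient eventually grows by 2Λ, a contradiction:
`not_geometric_bound_of_superlinear_growth`.

The upper bound on Y also confines the values of u that enter the comparison to a bounded interval.
There f(s) ≥ c s^p follows from the liminf near 0 and from compactness away from 0
(`exists_rpow_le_of_liminf_pos`), so the behaviour of f at infinity plays no role.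

The differential inequality enters this growth argument only through `ComparisonPrinciple`. Its
boundary data live on collars of width η instead of spheres, so that it makes sense almost
everywhere, and its strict inequality is required only where u < φ. Classical solutions are
viscosity solutions, and for these the barrier itself is the test function at an interior minimum of
u − φ. Weak solutions are mollified and composed with a convex truncation. The initial positive
lower bound on a shell comes from lower semicontinuity in the viscosity case, and in the weak case
from radial means that increase as the radius shrinks (`exists_pos_lower_bound`). -/

/-! ### Second-order conditions at a minimum; classical solutions are viscosity solutions. -/

/-- For a `C²` function, the Laplacian is the sum of iterated directional derivatives. -/
theorem laplacian_eq_sum_fderiv_fderiv {n : ℕ} {f : EuclideanSpace ℝ (Fin n) → ℝ}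
    {x : EuclideanSpace ℝ (Fin n)} (hf : ContDiffAt ℝ 2 f x) :
    Laplacian.laplacian f x = ∑ i, fderiv ℝ (fun y => fderiv ℝ f y (EuclideanSpace.basisFun (Fin n) ℝ i)) x
      (EuclideanSpace.basisFun (Fin n) ℝ i) := by
  rw [InnerProductSpace.laplacian_eq_iteratedFDeriv_orthonormalBasis f
    (EuclideanSpace.basisFun (Fin n) ℝ)]
  refine Finset.sum_congr rfl fun i _ => ?_
  rw [iteratedFDeriv_two_apply]
  have hd : DifferentiableAt ℝ (fderiv ℝ f) x :=
    (hf.fderiv_right (m := 1) (by norm_num)).differentiableAt (by norm_num)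
  rw [fderiv_clm_apply hd (differentiableAt_const _)]
  simp

/-- At a local minimum the second directional derivatives are nonnegative. -/
theorem IsLocalMin.fderiv_fderiv_nonneg {E : Type*} [NormedAddCommGroup E] [NormedSpace ℝ E]
    {g : E → ℝ} {x : E} (hg : ContDiffAt ℝ 2 g x) (h : IsLocalMin g x) (v : E) :
    0 ≤ fderiv ℝ (fun y => fderiv ℝ g y v) x v := by
  have hline : ∀ t : ℝ, HasDerivAt (fun t : ℝ => x + t • v) v t := fun t => by
    simpa using ((hasDerivAt_id t).smul_const v).const_add x
  have hcont : Filter.Tendsto (fun t : ℝ => x + t • v) (𝓝 0) (𝓝 x) := by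
    simpa using (hline 0).continuousAt.tendsto
  have hev : ∀ᶠ y in 𝓝 x, ContDiffAt ℝ 2 g y := hg.eventually (by simp)
  have hderiv : ∀ᶠ t in 𝓝 (0 : ℝ), deriv (fun t : ℝ => g (x + t • v)) t = fderiv ℝ g (x + t • v) v := by
    filter_upwards [hcont.eventually hev] with t ht
    exact ((ht.differentiableAt (by norm_num)).hasFDerivAt.comp_hasDerivAt t (hline t)).deriv
  have hd : DifferentiableAt ℝ (fun y => fderiv ℝ g y v) x :=
    ((hg.fderiv_right (m := 1) (by norm_num)).differentiableAt (by norm_num)).clm_apply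
      (differentiableAt_const _)
  have hd0 : DifferentiableAt ℝ (fun y => fderiv ℝ g y v) (x + (0 : ℝ) • v) := by simpa using hd
  have hsecond : deriv (deriv (fun t : ℝ => g (x + t • v))) 0 =
      fderiv ℝ (fun y => fderiv ℝ g y v) x v := by
    rw [Filter.EventuallyEq.deriv_eq hderiv]
    have := (hd0.hasFDerivAt.comp_hasDerivAt (0 : ℝ) (hline 0)).deriv
    simpa [Function.comp_def] using this
  have hmin : IsLocalMin (fun t : ℝ => g (x + t • v)) 0 := by
    have := hcont.eventually h
    simpa [IsLocalMin, IsMinFilter] using this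
  by_contra hneg
  push Not at hneg
  rw [← hsecond] at hneg
  have hc : ContinuousAt (fun t : ℝ => g (x + t • v)) 0 := by
    refine ContinuousAt.comp (x := (0 : ℝ)) (g := g) ?_ (hline 0).continuousAt
    simpa using hg.continuousAt
  -- A critical point with negative second derivative is also a local maximum, so the restriction to
  -- the line is locally constant and its second derivative vanishes after all.
  have hmax := isLocalMax_of_deriv_deriv_neg hneg hmin.deriv_eq_zero hc
  have hconst : (fun t : ℝ => g (x + t • v)) =ᶠ[𝓝 0] fun _ => g x := by
    filter_upwards [hmin, hmax] with t h1 h2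
    simp only [zero_smul, add_zero] at h1 h2
    exact le_antisymm h2 h1
  have h1 : deriv (fun t : ℝ => g (x + t • v)) =ᶠ[𝓝 0] deriv fun _ => g x := hconst.deriv
  rw [h1.deriv_eq] at hneg
  simp at hneg

theorem IsLocalMin.laplacian_nonneg {n : ℕ} {g : EuclideanSpace ℝ (Fin n) → ℝ}
    {x : EuclideanSpace ℝ (Fin n)} (hg : ContDiffAt ℝ 2 g x) (h : IsLocalMin g x) :
    0 ≤ Laplacian.laplacian g x := by
  rw [laplacian_eq_sum_fderiv_fderiv hg]
  exact Finset.sum_nonneg fun i _ => h.fderiv_fderiv_nonneg hg _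

/-- Classical supersolutions are viscosity supersolutions. -/
theorem IsClassicalSupersolution.isViscositySupersolution {n : ℕ} {f : ℝ → ℝ}
    {Ω : Set (EuclideanSpace ℝ (Fin n))} (hΩ : IsOpen Ω) {u : EuclideanSpace ℝ (Fin n) → ℝ}
    (hu : IsClassicalSupersolution f Ω u) : IsViscositySupersolution f Ω u := by
  refine ⟨hu.1.continuousOn.lowerSemicontinuousOn, fun x hx φ hφ hmin => ?_⟩
  have hu2 : ContDiffAt ℝ 2 u x := hu.1.contDiffAt (hΩ.mem_nhds hx)
  have hφ2 : ContDiffAt ℝ 2 φ x := hφ.contDiffAt (hΩ.mem_nhds hx)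
  have h := (hmin.isLocalMin (hΩ.mem_nhds hx)).laplacian_nonneg (hu2.sub hφ2)
  have h2 := hu2.laplacian_sub hφ2
  have h3 : Laplacian.laplacian (fun x => u x - φ x) x =
      Laplacian.laplacian u x - Laplacian.laplacian φ x := h2
  linarith [hu.2 x hx]

/-! ### Radial functions and barriers. -/

/-- The Laplacian of a radial function, written in terms of the squared norm. -/
theorem laplacian_comp_norm_sq {n : ℕ} {h h' : ℝ → ℝ} {h'' : ℝ} {x : EuclideanSpace ℝ (Fin n)}
    (hc : ContDiffAt ℝ 2 h (‖x‖ ^ 2))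
    (h1 : ∀ᶠ s in 𝓝 (‖x‖ ^ 2), HasDerivAt h (h' s) s) (h2 : HasDerivAt h' h'' (‖x‖ ^ 2)) :
    Laplacian.laplacian (fun y : EuclideanSpace ℝ (Fin n) => h (‖y‖ ^ 2)) x =
      4 * ‖x‖ ^ 2 * h'' + 2 * n * h' (‖x‖ ^ 2) := by
  have hsq : ∀ y : EuclideanSpace ℝ (Fin n),
      HasFDerivAt (fun y => ‖y‖ ^ 2) (2 • innerSL ℝ y) y := fun y => by
    simpa using (hasFDerivAt_id y).norm_sq
  have hcont : ContDiff ℝ 2 (fun y : EuclideanSpace ℝ (Fin n) => ‖y‖ ^ 2) := contDiff_norm_sq ℝ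
  have hcomp : ContDiffAt ℝ 2 (fun y : EuclideanSpace ℝ (Fin n) => h (‖y‖ ^ 2)) x :=
    hc.comp x hcont.contDiffAt
  rw [laplacian_eq_sum_fderiv_fderiv hcomp]
  have hd : ∀ v : EuclideanSpace ℝ (Fin n), (fun y => fderiv ℝ (fun y => h (‖y‖ ^ 2)) y v) =ᶠ[𝓝 x]
      fun y => h' (‖y‖ ^ 2) * (2 * ⟪y, v⟫_ℝ) := fun v => by
    filter_upwards [hcont.continuous.continuousAt.eventually h1] with y hy
    have := (hy.comp_hasFDerivAt y (hsq y)).fderiv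
    rw [show (fun y : EuclideanSpace ℝ (Fin n) => h (‖y‖ ^ 2)) = h ∘ (fun y => ‖y‖ ^ 2) from rfl, this]
    simp
  have hv : ∀ v : EuclideanSpace ℝ (Fin n), ‖v‖ = 1 →
      fderiv ℝ (fun y => fderiv ℝ (fun y => h (‖y‖ ^ 2)) y v) x v =
      4 * h'' * ⟪x, v⟫_ℝ ^ 2 + 2 * h' (‖x‖ ^ 2) := fun v hv => by
    rw [(hd v).fderiv_eq]
    have e1 : HasFDerivAt (fun y : EuclideanSpace ℝ (Fin n) => h' (‖y‖ ^ 2)) (h'' • (2 • innerSL ℝ x)) x :=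
      h2.comp_hasFDerivAt x (hsq x)
    have e2 : HasFDerivAt (fun y : EuclideanSpace ℝ (Fin n) => 2 * ⟪y, v⟫_ℝ)
        ((2 : ℝ) • innerSL ℝ v) x := by
      have : HasFDerivAt (fun y : EuclideanSpace ℝ (Fin n) => ⟪v, y⟫_ℝ) (innerSL ℝ v) x :=
        (innerSL ℝ v).hasFDerivAt
      simpa [real_inner_comm] using this.const_mul 2
    have e3 : HasFDerivAt (fun y : EuclideanSpace ℝ (Fin n) => h' (‖y‖ ^ 2) * (2 * ⟪y, v⟫_ℝ)) _ x :=
      e1.mul e2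
    rw [e3.fderiv]
    simp [hv]
    ring
  rw [Finset.sum_congr rfl fun i _ => hv (EuclideanSpace.basisFun (Fin n) ℝ i) (by simp),
    Finset.sum_add_distrib, ← Finset.mul_sum]
  have := (EuclideanSpace.basisFun (Fin n) ℝ).sum_sq_norm_inner_right x
  have h3 : ∑ i, ⟪x, EuclideanSpace.basisFun (Fin n) ℝ i⟫_ℝ ^ 2 = ‖x‖ ^ 2 := by
    rw [← this]
    refine Finset.sum_congr rfl fun i _ => ?_
    rw [real_inner_comm, Real.norm_eq_abs, sq_abs]
  rw [h3]
  simp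
  ring

/-- The radial barriers `|x|⁻ᴺ (β + κ log |x|) + α`, `N = n - 2`, extended smoothly to all of `ℝⁿ`. -/
theorem exists_radial_barrier {n : ℕ} (α β κ : ℝ) {a : ℝ} (ha : 0 < a) :
    ∃ φ : EuclideanSpace ℝ (Fin n) → ℝ, ContDiff ℝ ∞ φ ∧
      (∀ x, a ≤ ‖x‖ → φ x = ‖x‖ ^ (-((n : ℝ) - 2)) * (β + κ * Real.log ‖x‖) + α) ∧
      ∀ x, a ≤ ‖x‖ → -(Laplacian.laplacian φ x) = κ * ((n : ℝ) - 2) * ‖x‖ ^ (-(n : ℝ)) := by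
  set N : ℝ := (n : ℝ) - 2 with hN
  -- The variable is s = |x|², which halves both the exponent and the coefficient of the logarithm.
  set h : ℝ → ℝ := fun s => s ^ (-N / 2) * (β + κ / 2 * Real.log s) + α with hh
  -- The cutoff vanishes for s ≤ a²/2 and equals 1 for s ≥ 3a²/4. The barrier thus has its exact
  -- formula on a neighbourhood of |x| ≥ a, so its Laplacian is exact there, boundary sphere
  -- included.
  set χ : ℝ → ℝ := fun s => Real.smoothTransition (4 * s / a ^ 2 - 2) with hχ
  have ha2 : 0 < a ^ 2 := by positivity
  have hχc : ContDiff ℝ ∞ χ := by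
    refine Real.smoothTransition.contDiff.comp ?_
    fun_prop
  have hhc : ∀ s : ℝ, 0 < s → ContDiffAt ℝ ∞ h s := fun s hs => by
    refine ((Real.contDiffAt_rpow_const_of_ne hs.ne').mul
      (contDiffAt_const.add (contDiffAt_const.mul (Real.contDiffAt_log.2 hs.ne')))).add contDiffAt_const
  have hprod : ContDiff ℝ ∞ fun s => χ s * h s := by
    rw [contDiff_iff_contDiffAt]
    intro s
    rcases lt_or_ge 0 s with hs | hs
    · exact hχc.contDiffAt.mul (hhc s hs)
    · have : (fun s => χ s * h s) =ᶠ[𝓝 s] fun _ => 0 := by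
        filter_upwards [Iio_mem_nhds (show s < a ^ 2 / 2 by linarith)] with t ht
        have : χ t = 0 := Real.smoothTransition.zero_of_nonpos (by
          rw [sub_nonpos, div_le_iff₀ ha2]
          have : t < a ^ 2 / 2 := ht
          linarith)
        simp [this]
      exact contDiffAt_const.congr_of_eventuallyEq this
  have heq : ∀ s, 3 * a ^ 2 / 4 ≤ s → χ s * h s = h s := fun s hs => by
    have : χ s = 1 := Real.smoothTransition.one_of_one_le (by
      rw [le_sub_iff_add_le, le_div_iff₀ ha2]
      linarith)
    simp [this]
  refine ⟨fun x => χ (‖x‖ ^ 2) * h (‖x‖ ^ 2), hprod.comp (contDiff_norm_sq ℝ), fun x hx => ?_,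
    fun x hx => ?_⟩
  · have hx0 : 0 < ‖x‖ := ha.trans_le hx
    change χ (‖x‖ ^ 2) * h (‖x‖ ^ 2) = _
    rw [heq _ (by nlinarith), hh]
    simp only
    rw [← Real.rpow_natCast ‖x‖ 2, ← Real.rpow_mul hx0.le, Real.log_rpow hx0]
    congr 3
    · push_cast
      ring
    · push_cast
      ring
  · have hx0 : 0 < ‖x‖ := ha.trans_le hx
    have hx2 : 3 * a ^ 2 / 4 < ‖x‖ ^ 2 := by nlinarith
    set h' : ℝ → ℝ := fun s => s ^ (-N / 2 - 1) * (-N / 2 * (β + κ / 2 * Real.log s) + κ / 2)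
    have d0 : ∀ s : ℝ, 0 < s → HasDerivAt h (h' s) s := fun s hs => by
      have := ((Real.hasDerivAt_rpow_const (p := -N / 2) (Or.inl hs.ne')).mul
        (((Real.hasDerivAt_log hs.ne').const_mul (κ / 2)).const_add β)).add_const α
      refine this.congr_deriv ?_
      have e : s ^ (-N / 2) = s ^ (-N / 2 - 1) * s := by
        rw [Real.rpow_sub_one hs.ne']; field_simp
      rw [e]
      simp only [h']
      field_simp
    have d1 : ∀ᶠ s in 𝓝 (‖x‖ ^ 2), HasDerivAt (fun s => χ s * h s) (h' s) s := by
      filter_upwards [Ioi_mem_nhds hx2] with s hs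
      have hs' : 3 * a ^ 2 / 4 < s := hs
      refine (d0 s (by linarith)).congr_of_eventuallyEq ?_
      filter_upwards [Ioi_mem_nhds hs'] with t ht
      exact heq t (le_of_lt ht)
    set s := ‖x‖ ^ 2 with hs
    have hs0 : 0 < s := by positivity
    have d2 := ((Real.hasDerivAt_rpow_const (p := -N / 2 - 1) (Or.inl hs0.ne')).mul
        (((((Real.hasDerivAt_log hs0.ne').const_mul (κ / 2)).const_add β).const_mul (-N / 2)).add_const
          (κ / 2)))
    rw [laplacian_comp_norm_sq (contDiff_infty.1 hprod 2).contDiffAt d1 d2]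
    have e1 : s ^ (-N / 2 - 1) = ‖x‖ ^ (-(n : ℝ)) := by
      rw [hs, ← Real.rpow_natCast ‖x‖ 2, ← Real.rpow_mul hx0.le]
      congr 1
      push_cast
      rw [hN]
      ring
    have e2 : s ^ (-N / 2 - 1 - 1) = ‖x‖ ^ (-(n : ℝ)) / s := by
      rw [Real.rpow_sub_one hs0.ne', e1]
    simp only [h', ← hs, e1, e2]
    have e3 : (n : ℝ) = N + 2 := by rw [hN]; ring
    generalize ‖x‖ ^ (-(n : ℝ)) = q
    rw [e3]
    field_simp
    ring

/-! ### Lower bounds for the nonlinearity, and a superlinear recursion. -/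

/-- The growth condition near `0` and positivity give `f s ≥ c s ^ p` on every bounded interval. -/
theorem exists_rpow_le_of_liminf_pos {f : ℝ → ℝ} {p : ℝ} (hp : 0 < p)
    (hf_cont : ContinuousOn f (Set.Ioi 0)) (hf_pos : ∀ s : ℝ, 0 < s → 0 < f s)
    (hf_liminf : (0 : EReal) <
      Filter.liminf (fun s : ℝ => ((s ^ (-p) * f s : ℝ) : EReal)) (𝓝[>] (0 : ℝ))) (C : ℝ) :
    ∃ c : ℝ, 0 < c ∧ ∀ s, 0 < s → s ≤ C → c * s ^ p ≤ f s := by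
  obtain ⟨c, hc0, hc1⟩ := EReal.lt_iff_exists_real_btwn.1 hf_liminf
  have hev := Filter.eventually_lt_of_lt_liminf hc1
  obtain ⟨s₀, hs₀, hs⟩ := mem_nhdsGT_iff_exists_Ioo_subset.1 hev
  have hs₀ : 0 < s₀ := hs₀
  have hc0 : 0 < c := by exact_mod_cast hc0
  have hsmall : ∀ s, 0 < s → s < s₀ → c * s ^ p ≤ f s := fun s h0 h1 => by
    have h : (c : EReal) < ((s ^ (-p) * f s : ℝ) : EReal) := hs ⟨h0, h1⟩
    have h : c < s ^ (-p) * f s := by exact_mod_cast h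
    have hsp : 0 < s ^ p := Real.rpow_pos_of_pos h0 p
    rw [Real.rpow_neg h0.le, inv_mul_eq_div, lt_div_iff₀ hsp] at h
    exact h.le
  rcases lt_or_ge C s₀ with hC | hC
  · exact ⟨c, hc0, fun s h0 h1 => hsmall s h0 (h1.trans_lt hC)⟩
  have hsub : Set.Icc s₀ C ⊆ Set.Ioi 0 := fun s hs => hs₀.trans_le hs.1
  obtain ⟨t, ht, htmin⟩ := isCompact_Icc.exists_isMinOn (Set.nonempty_Icc.2 hC)
    (hf_cont.mono hsub)
  have hC0 : 0 < C := hs₀.trans_le hC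
  have hCp : 0 < C ^ p := Real.rpow_pos_of_pos hC0 p
  have hft := hf_pos t (hsub ht)
  -- On [s₀, C] the minimum of f is f t > 0, while s^p ≤ C^p.
  refine ⟨min c (f t / C ^ p), lt_min hc0 (by positivity), fun s h0 h1 => ?_⟩
  have hsp : 0 < s ^ p := Real.rpow_pos_of_pos h0 p
  rcases lt_or_ge s s₀ with h | h
  · exact (mul_le_mul_of_nonneg_right (min_le_left _ _) hsp.le).trans (hsmall s h0 h)
  · calc min c (f t / C ^ p) * s ^ p ≤ f t / C ^ p * C ^ p := by
          gcongr
          exact min_le_right _ _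
      _ = f t := by field_simp
      _ ≤ f s := htmin ⟨h, h1⟩

/-- A positive sequence with `y (k + 1) ≥ y k + min (c (y k) ^ p) (K y k)`, `p > 1`, outgrows every
geometric sequence of ratio less than `1 + K`. -/
theorem not_geometric_bound_of_superlinear_growth {y : ℕ → ℝ} {c p K Λ A : ℝ} (hc : 0 < c)
    (hp : 1 < p) (hΛ : 1 ≤ Λ) (hK : 1 + K = 2 * Λ) (hy0 : 0 < y 0)
    (hy : ∀ k, y k + min (c * y k ^ p) (K * y k) ≤ y (k + 1)) (hA : ∀ k, y k ≤ A * Λ ^ k) : False := by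
  have hK0 : 0 < K := by linarith
  have hge : ∀ k, y 0 ≤ y k := fun k => by
    induction k with
    | zero => exact le_rfl
    | succ k ih =>
      have hk : 0 < y k := hy0.trans_le ih
      have : 0 ≤ min (c * y k ^ p) (K * y k) := le_min (by positivity) (by positivity)
      linarith [hy k]
  have hpos : ∀ k, 0 < y k := fun k => hy0.trans_le (hge k)
  -- The increment is a nondecreasing function of y, so it never falls below its initial value d.
  -- This linear growth already sends y to infinity.
  set d := min (c * y 0 ^ p) (K * y 0) with hd
  have hd0 : 0 < d := lt_min (by positivity) (by positivity)
  have hlin : ∀ k : ℕ, k * d ≤ y k := fun k => by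
    induction k with
    | zero => simpa using hy0.le
    | succ k ih =>
      have : d ≤ min (c * y k ^ p) (K * y k) := by
        have := hge k
        apply min_le_min <;> gcongr
      push_cast
      linarith [hy k]
  have htend : Filter.Tendsto y Filter.atTop Filter.atTop :=
    Filter.tendsto_atTop_mono hlin (tendsto_natCast_atTop_atTop.atTop_mul_const hd0)
  have hpow := (tendsto_rpow_atTop (show 0 < p - 1 by linarith)).comp htend
  obtain ⟨k₀, hk₀⟩ := Filter.eventually_atTop.1 (hpow.eventually_ge_atTop (K / c))
  -- Once y^(p−1) ≥ K/c the minimum is attained by K y, and each step multiplies y by at least 1 + K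
  -- = 2Λ. Against a bound of order Λ^k this leaves 2^j bounded.
  have hstep : ∀ k, k₀ ≤ k → 2 * Λ * y k ≤ y (k + 1) := fun k hk => by
    have h1 : K / c ≤ y k ^ (p - 1) := hk₀ k hk
    rw [div_le_iff₀ hc, Real.rpow_sub_one (hpos k).ne', div_mul_eq_mul_div,
      le_div_iff₀ (hpos k)] at h1
    have h2 := hy k
    rw [min_eq_right (by linarith)] at h2
    rw [← hK]
    linarith
  have hgeo : ∀ j : ℕ, (2 * Λ) ^ j * y k₀ ≤ y (k₀ + j) := fun j => by
    induction j with
    | zero => simp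
    | succ j ih =>
      have := hstep (k₀ + j) (Nat.le_add_right _ _)
      calc (2 * Λ) ^ (j + 1) * y k₀ = 2 * Λ * ((2 * Λ) ^ j * y k₀) := by ring
        _ ≤ 2 * Λ * y (k₀ + j) := by gcongr
        _ ≤ _ := this
  have htwo : ∀ j : ℕ, (2 : ℝ) ^ j ≤ A * Λ ^ k₀ / y k₀ := fun j => by
    rw [le_div_iff₀ (hpos k₀)]
    have h := (hgeo j).trans (hA (k₀ + j))
    have hΛj : 0 < Λ ^ j := by positivity
    refine le_of_mul_le_mul_right ?_ hΛj
    calc 2 ^ j * y k₀ * Λ ^ j = (2 * Λ) ^ j * y k₀ := by rw [mul_pow]; ring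
      _ ≤ A * Λ ^ (k₀ + j) := h
      _ = A * Λ ^ k₀ * Λ ^ j := by ring
  obtain ⟨j, hj⟩ := pow_unbounded_of_one_lt (A * Λ ^ k₀ / y k₀) (show (1 : ℝ) < 2 by norm_num)
  exact (htwo j).not_gt hj

/-! ### Comparison in annuli and the growth argument. -/

/-- The comparison principle for `-Δu ≥ f(u)` in the annuli of `{|x| > R}`. The inequalities are
required to hold eventually along a filter `l`, so that the pointwise version (`l = ⊤`) and the
almost everywhere version are treated together. -/
def ComparisonPrinciple {n : ℕ} (l : Filter (EuclideanSpace ℝ (Fin n))) (f : ℝ → ℝ)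
    (u : EuclideanSpace ℝ (Fin n) → ℝ) (R : ℝ) : Prop :=
  ∀ (a b η : ℝ) (φ : EuclideanSpace ℝ (Fin n) → ℝ), R < a → 0 < η → ContDiff ℝ ∞ φ →
    (∀ᶠ x in l, a < ‖x‖ → ‖x‖ < b → (‖x‖ < a + η ∨ b - η < ‖x‖) → φ x ≤ u x) →
    (∀ᶠ x in l, a < ‖x‖ → ‖x‖ < b → u x < φ x → -(Laplacian.laplacian φ x) < f (u x)) →
    ∀ᶠ x in l, a < ‖x‖ → ‖x‖ < b → φ x ≤ u x

/-- Powers dominate logarithms. A barrier lowered by any positive constant is hence nonpositive far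
out, which settles the outer boundary condition. -/
theorem tendsto_rpow_neg_mul_log {N : ℝ} (hN : 0 < N) (β κ : ℝ) :
    Filter.Tendsto (fun r : ℝ => r ^ (-N) * (β + κ * Real.log r)) Filter.atTop (𝓝 0) := by
  have h1 : Filter.Tendsto (fun r : ℝ => r ^ (-N)) Filter.atTop (𝓝 0) := tendsto_rpow_neg_atTop hN
  have h2 : Filter.Tendsto (fun r : ℝ => Real.log r / r ^ N) Filter.atTop (𝓝 0) :=
    (isLittleO_log_rpow_atTop hN).tendsto_div_nhds_zero
  have h3 := (h1.mul_const β).add (h2.const_mul κ)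
  simp only [zero_mul, mul_zero, add_zero] at h3
  refine h3.congr' ?_
  filter_upwards [Filter.eventually_gt_atTop 0] with r hr
  rw [Real.rpow_neg hr.le]
  field_simp

namespace ComparisonPrinciple

variable {n : ℕ} {l : Filter (EuclideanSpace ℝ (Fin n))} {f : ℝ → ℝ}
  {u : EuclideanSpace ℝ (Fin n) → ℝ} {R : ℝ}

/-- Comparison with a barrier that vanishes at infinity. -/
theorem barrier_le [CountableInterFilter l] (hn : 3 ≤ n) (hR : 0 < R)
    (h : ComparisonPrinciple l f u R) {a a' β κ : ℝ} (ha : R < a) (haa' : a < a')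
    (hu : ∀ᶠ x in l, R < ‖x‖ → 0 < u x)
    (hinner : ∀ᶠ x in l, a < ‖x‖ → ‖x‖ < a' →
      ‖x‖ ^ (-((n : ℝ) - 2)) * (β + κ * Real.log ‖x‖) ≤ u x)
    (hsub : ∀ᶠ x in l, a < ‖x‖ → u x < ‖x‖ ^ (-((n : ℝ) - 2)) * (β + κ * Real.log ‖x‖) →
      κ * ((n : ℝ) - 2) * ‖x‖ ^ (-(n : ℝ)) < f (u x)) :
    ∀ᶠ x in l, a < ‖x‖ → ‖x‖ ^ (-((n : ℝ) - 2)) * (β + κ * Real.log ‖x‖) ≤ u x := by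
  have ha0 : 0 < a := hR.trans ha
  have hn' : (3 : ℝ) ≤ n := by exact_mod_cast hn
  have hN : 0 < (n : ℝ) - 2 := by linarith
  have hlim := tendsto_rpow_neg_mul_log hN β κ
  have key : ∀ k : ℕ, ∀ᶠ x in l, a < ‖x‖ → ‖x‖ < k →
      ‖x‖ ^ (-((n : ℝ) - 2)) * (β + κ * Real.log ‖x‖) + -(1 / ((k : ℝ) + 1)) ≤ u x := fun k => by
    have hδ : (0 : ℝ) < 1 / ((k : ℝ) + 1) := Nat.one_div_pos_of_nat
    obtain ⟨b, hb⟩ := Filter.eventually_atTop.1 (hlim.eventually_le_const hδ)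
    obtain ⟨φ, hφ, hφ_eq, hφ_lap⟩ := exists_radial_barrier (n := n) (-(1 / ((k : ℝ) + 1))) β κ ha0
    -- The outer radius exceeds b by at least 1, so the outer collar lies where the lowered barrier
    -- is nonpositive and u is positive; it is also at least k, so the annuli exhaust |x| > a. The
    -- width a' − a keeps the inner collar inside the region of `hinner`.
    have hc := h a (max (b + 1) k) (min (a' - a) 1) φ ha (lt_min (by linarith) one_pos) hφ ?_ ?_
    · filter_upwards [hc] with x hx h1 h2
      have := hx h1 (h2.trans_le (le_max_right _ _))
      rwa [hφ_eq x h1.le] at this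
    · filter_upwards [hinner, hu] with x hx hux h1 h2 h3
      rw [hφ_eq x h1.le]
      rcases h3 with h3 | h3
      · have := hx h1 (h3.trans_le (by linarith [min_le_left (a' - a) 1]))
        linarith
      · have h4 : b ≤ ‖x‖ := by
          linarith [min_le_right (a' - a) 1, le_max_left (b + 1) (k : ℝ)]
        linarith [hb _ h4, hux (ha.trans h1)]
    · filter_upwards [hsub] with x hx h1 h2 h3
      rw [hφ_lap x h1.le]
      rw [hφ_eq x h1.le] at h3
      exact hx h1 (by linarith)
  -- Only countably many lowered barriers are used, so one exceptional set serves all of them before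
  -- the lowering 1/(k + 1) tends to 0.
  filter_upwards [eventually_countable_forall.2 key] with x hx h1
  obtain ⟨k₀, hk₀⟩ := exists_nat_gt ‖x‖
  have ht : Filter.Tendsto (fun k : ℕ => ‖x‖ ^ (-((n : ℝ) - 2)) * (β + κ * Real.log ‖x‖)
      + -(1 / ((k : ℝ) + 1))) Filter.atTop
      (𝓝 (‖x‖ ^ (-((n : ℝ) - 2)) * (β + κ * Real.log ‖x‖) + -0)) :=
    tendsto_const_nhds.add tendsto_one_div_add_atTop_nhds_zero_nat.neg
  rw [neg_zero, add_zero] at ht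
  refine le_of_tendsto ht ?_
  filter_upwards [Filter.eventually_ge_atTop k₀] with k hk
  exact hx k h1 (hk₀.trans_le (by exact_mod_cast hk))

/-- A lower bound in a shell propagates outwards, with the decay of the fundamental solution. -/
theorem exists_fundamental_lower_bound [CountableInterFilter l] (hn : 3 ≤ n) (hR : 0 < R)
    (h : ComparisonPrinciple l f u R) (hf : ∀ s, 0 < s → 0 < f s) {a b μ : ℝ} (ha : R < a)
    (hab : a < b) (hμ : 0 < μ) (hu : ∀ᶠ x in l, R < ‖x‖ → 0 < u x)
    (hinit : ∀ᶠ x in l, a < ‖x‖ → ‖x‖ < b → μ ≤ u x) :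
    ∃ Y, 0 < Y ∧ ∀ᶠ x in l, a < ‖x‖ → Y * ‖x‖ ^ (-((n : ℝ) - 2)) ≤ u x := by
  have ha0 : 0 < a := hR.trans ha
  have hn' : (3 : ℝ) ≤ n := by exact_mod_cast hn
  have hN : 0 < (n : ℝ) - 2 := by linarith
  -- With this coefficient the harmonic barrier equals μ on |x| = a and is smaller beyond.
  refine ⟨μ * a ^ ((n : ℝ) - 2), by positivity, ?_⟩
  have hb := h.barrier_le (β := μ * a ^ ((n : ℝ) - 2)) (κ := 0) hn hR ha hab hu ?_ ?_
  · filter_upwards [hb] with x hx h1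
    have := hx h1
    simp only [zero_mul, add_zero] at this
    linarith
  · filter_upwards [hinit] with x hx h1 h2
    refine le_trans ?_ (hx h1 h2)
    have hx0 : 0 < ‖x‖ := ha0.trans h1
    have h3 : a ^ ((n : ℝ) - 2) ≤ ‖x‖ ^ ((n : ℝ) - 2) := Real.rpow_le_rpow ha0.le h1.le hN.le
    have h4 : 0 < ‖x‖ ^ ((n : ℝ) - 2) := Real.rpow_pos_of_pos hx0 _
    rw [Real.rpow_neg hx0.le, inv_mul_le_iff₀ h4]
    simp only [zero_mul, add_zero]
    rw [mul_comm]
    exact mul_le_mul_of_nonneg_right h3 hμ.le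
  · filter_upwards [hu] with x hx h1 _
    simpa using hf _ (hx (ha.trans h1))

/-- A lower bound `Y |x|⁻ᴺ` for `|x| > ρ` can only hold with `Y` of order at most `ρᴺ`. -/
theorem exists_upper_bound [CountableInterFilter l] (hn : 3 ≤ n) (hR : 0 < R)
    (h : ComparisonPrinciple l f u R) (hf : ∀ s, 0 < s → 0 < f s)
    (hu : ∀ᶠ x in l, R < ‖x‖ → 0 < u x)
    (hshell : ∀ a b, R < a → a < b → ∃ᶠ x in l, a < ‖x‖ ∧ ‖x‖ < b) :
    ∃ C, 0 < C ∧ ∀ ρ Y, 4 * R ≤ ρ → 0 < Y →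
      (∀ᶠ x in l, ρ < ‖x‖ → Y * ‖x‖ ^ (-((n : ℝ) - 2)) ≤ u x) → Y ≤ C * ρ ^ ((n : ℝ) - 2) := by
  have hn' : (3 : ℝ) ≤ n := by exact_mod_cast hn
  set N : ℝ := (n : ℝ) - 2 with hNdef
  have hN : 1 ≤ N := by linarith
  -- If every level k were a lower bound on this shell, u would exceed all integers at a single
  -- point of it.
  have hfin : ∃ k : ℕ, ¬ ∀ᶠ x in l, 4 * R < ‖x‖ → ‖x‖ < 8 * R → (k : ℝ) ≤ u x := by
    by_contra hcon
    push Not at hcon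
    refine hshell (4 * R) (8 * R) (by linarith) (by linarith) ?_
    filter_upwards [eventually_countable_forall.2 hcon] with x hx hx2
    obtain ⟨k, hk⟩ := exists_nat_gt (u x)
    exact (hx k hx2.1 hx2.2).not_gt hk
  obtain ⟨k, hk⟩ := hfin
  refine ⟨(k + 1) * 2 * 2 ^ N, by positivity, fun ρ Y hρ hY hP => ?_⟩
  have hρ0 : 0 < ρ := by linarith
  by_contra hcon
  push Not at hcon
  apply hk
  -- M is the smallest value of Y|x|^(−N) on ρ < |x| < 2ρ. The harmonic barrier M(1 − (2R/|x|)^N)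
  -- vanishes on |x| = 2R and is at least M/2 for |x| ≥ 4R. If Y exceeded the claimed bound, M/2
  -- would be at least k.
  set M := Y * (2 * ρ) ^ (-N) with hM
  have hMk : (k : ℝ) * 2 ≤ M := by
    have h2ρ : 0 < (2 * ρ) ^ N := by positivity
    rw [hM, Real.rpow_neg (by positivity), ← div_eq_mul_inv, le_div_iff₀ h2ρ,
      Real.mul_rpow (by norm_num) hρ0.le]
    have : 0 < (2 : ℝ) ^ N * ρ ^ N := by positivity
    nlinarith
  have hM0 : 0 < M := by positivity
  obtain ⟨φ, hφ, hφ_eq, hφ_lap⟩ :=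
    exists_radial_barrier (n := n) M (-(M * (2 * R) ^ N)) 0 (a := 3 / 2 * R) (by positivity)
  have hφ_eq' : ∀ x, 3 / 2 * R ≤ ‖x‖ → φ x = M * (1 - (2 * R / ‖x‖) ^ N) := fun x hx => by
    have hx0 : 0 < ‖x‖ := by linarith
    rw [hφ_eq x hx, ← hNdef, Real.rpow_neg hx0.le, Real.div_rpow (by positivity) hx0.le]
    field_simp
    ring
  -- The inner collar stays within |x| ≤ 2R, where the barrier is nonpositive; the outer one lies in
  -- ρ < |x| < 2ρ, where the barrier is below Y|x|^(−N). Since ρ ≥ 4R, the annulus contains the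
  -- shell 4R < |x| < 8R.
  have hc := h (3 / 2 * R) (2 * ρ) (min (R / 2) ρ) φ (by linarith)
    (lt_min (by linarith) hρ0) hφ ?_ ?_
  · filter_upwards [hc] with x hx h1 h2
    have hx0 : 0 < ‖x‖ := by linarith
    have h3 := hx (by linarith) (by linarith)
    rw [hφ_eq' x (by linarith)] at h3
    have h4 : (2 * R / ‖x‖) ^ N ≤ (2 * R / ‖x‖) ^ (1 : ℝ) := by
      refine Real.rpow_le_rpow_of_exponent_ge (by positivity) ?_ hN
      rw [div_le_one hx0]
      linarith
    have h5 : 2 * R / ‖x‖ ≤ 1 / 2 := by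
      rw [div_le_div_iff₀ hx0 (by norm_num)]
      linarith
    rw [Real.rpow_one] at h4
    nlinarith
  · filter_upwards [hP, hu] with x hx hux h1 h2 h3
    have hx0 : 0 < ‖x‖ := by linarith
    rw [hφ_eq' x h1.le]
    have hpos : 0 ≤ (2 * R / ‖x‖) ^ N := by positivity
    rcases h3 with h3 | h3
    · have h4 : ‖x‖ ≤ 2 * R := by linarith [min_le_left (R / 2) ρ]
      have h5 : 1 ≤ (2 * R / ‖x‖) ^ N := by
        refine Real.one_le_rpow ?_ (by linarith)
        rwa [one_le_div hx0]
      have h6 := hux (by linarith)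
      nlinarith
    · have h4 : ρ < ‖x‖ := by linarith [min_le_right (R / 2) ρ]
      refine le_trans ?_ (hx h4)
      have h5 : (2 * ρ) ^ (-N) ≤ ‖x‖ ^ (-N) :=
        Real.rpow_le_rpow_of_nonpos hx0 h2.le (by linarith)
      have h6 : M ≤ Y * ‖x‖ ^ (-N) := mul_le_mul_of_nonneg_left h5 hY.le
      nlinarith
  · filter_upwards [hu] with x hux h1 h2 _
    rw [hφ_lap x h1.le]
    simpa using hf _ (hux (by linarith))

/-- The nonlinearity improves the lower bound `Y |x|⁻ᴺ`. -/
theorem improve_lower_bound [CountableInterFilter l] (hn : 3 ≤ n) (hR : 0 < R)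
    (h : ComparisonPrinciple l f u R) {ρ Y K C c : ℝ} (hρ : R < ρ) (hY : 0 < Y) (hK : 0 ≤ K)
    (hu : ∀ᶠ x in l, R < ‖x‖ → 0 < u x) (hYC : Y ≤ C * ρ ^ ((n : ℝ) - 2)) (hc : 0 < c)
    (hf : ∀ s, 0 < s → s ≤ (1 + K) * C → c * s ^ ((n : ℝ) / ((n : ℝ) - 2)) ≤ f s)
    (hP : ∀ᶠ x in l, ρ < ‖x‖ → Y * ‖x‖ ^ (-((n : ℝ) - 2)) ≤ u x) :
    ∀ᶠ x in l, 2 * Real.exp 1 * ρ < ‖x‖ →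
      (Y + min (c / (2 * ((n : ℝ) - 2)) * Y ^ ((n : ℝ) / ((n : ℝ) - 2))) (K * Y)) *
        ‖x‖ ^ (-((n : ℝ) - 2)) ≤ u x := by
  have hn' : (3 : ℝ) ≤ n := by exact_mod_cast hn
  set N : ℝ := (n : ℝ) - 2 with hNdef
  have hN : 1 ≤ N := by linarith
  have hN0 : 0 < N := by linarith
  have hρ0 : 0 < ρ := hR.trans hρ
  set p : ℝ := (n : ℝ) / N with hp
  have hYp : 0 < Y ^ p := Real.rpow_pos_of_pos hY p
  set κ := min (c / (2 * N) * Y ^ p) (K * Y) with hκ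
  have hκ0 : 0 ≤ κ := le_min (by positivity) (by positivity)
  have hρN : 0 < ρ ^ N := Real.rpow_pos_of_pos hρ0 N
  -- The barrier is |x|^(−N)(Y + κ log(|x|/2ρ)). It lies below the known bound Y|x|^(−N) while |x| ≤
  -- 2ρ, and above (Y + κ)|x|^(−N) once |x| ≥ 2eρ.
  have hb := h.barrier_le (a := ρ) (a' := 2 * ρ) (β := Y - κ * Real.log (2 * ρ)) (κ := κ) hn hR hρ
    (by linarith) hu ?_ ?_
  · filter_upwards [hb] with x hx h1
    have hexp : (1 : ℝ) ≤ Real.exp 1 := Real.one_le_exp zero_le_one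
    have hρx : ρ < ‖x‖ := by nlinarith
    have hx0 : 0 < ‖x‖ := hρ0.trans hρx
    refine le_trans ?_ (hx hρx)
    rw [mul_comm]
    refine mul_le_mul_of_nonneg_left ?_ (by positivity)
    have hlog : Real.log (2 * ρ) + 1 ≤ Real.log ‖x‖ := by
      rw [Real.le_log_iff_exp_le hx0, Real.exp_add, Real.exp_log (by positivity)]
      linarith
    nlinarith
  · filter_upwards [hP] with x hx h1 h2
    have hx0 : 0 < ‖x‖ := hρ0.trans h1
    refine le_trans ?_ (hx h1)
    rw [mul_comm Y]
    refine mul_le_mul_of_nonneg_left ?_ (by positivity)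
    have hlog : Real.log ‖x‖ ≤ Real.log (2 * ρ) := Real.log_le_log hx0 h2.le
    nlinarith
  · filter_upwards [hP] with x hx h1 h2
    have hx0 : 0 < ‖x‖ := hρ0.trans h1
    have hxN : 0 < ‖x‖ ^ (-N) := Real.rpow_pos_of_pos hx0 _
    have hlow := hx h1
    have hux : 0 < u x := lt_of_lt_of_le (by positivity) hlow
    have hlog : Real.log ‖x‖ - Real.log (2 * ρ) ≤ (‖x‖ / ρ) ^ N := by
      have h4 : Real.log (‖x‖ / ρ) ≤ (‖x‖ / ρ) ^ N := by
        have h5 : (1 : ℝ) ≤ ‖x‖ / ρ := by rw [one_le_div hρ0]; exact h1.le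
        calc Real.log (‖x‖ / ρ) ≤ ‖x‖ / ρ := Real.log_le_self (by positivity)
          _ = (‖x‖ / ρ) ^ (1 : ℝ) := (Real.rpow_one _).symm
          _ ≤ _ := Real.rpow_le_rpow_of_exponent_le h5 hN
      rw [Real.log_div hx0.ne' hρ0.ne'] at h4
      have h6 : Real.log ρ ≤ Real.log (2 * ρ) := Real.log_le_log hρ0 (by linarith)
      linarith
    -- Only points where u is below the barrier matter. There κ ≤ KY and log t ≤ t^N bound the
    -- barrier by (1 + K)Y/ρ^N, and Y ≤ Cρ^N bounds this by (1 + K)C.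
    have hup : u x ≤ (1 + K) * C := by
      have h3 : ‖x‖ ^ (-N) * (Y - κ * Real.log (2 * ρ) + κ * Real.log ‖x‖) ≤
          ‖x‖ ^ (-N) * (Y + K * Y * (‖x‖ / ρ) ^ N) := by
        refine mul_le_mul_of_nonneg_left ?_ hxN.le
        have h4 : κ * (Real.log ‖x‖ - Real.log (2 * ρ)) ≤ κ * (‖x‖ / ρ) ^ N :=
          mul_le_mul_of_nonneg_left hlog hκ0
        have h5 : κ * (‖x‖ / ρ) ^ N ≤ K * Y * (‖x‖ / ρ) ^ N :=
          mul_le_mul_of_nonneg_right (min_le_right _ _) (by positivity)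
        linarith
      have h4 : ‖x‖ ^ (-N) * (K * Y * (‖x‖ / ρ) ^ N) = K * (Y / ρ ^ N) := by
        rw [Real.div_rpow hx0.le hρ0.le, Real.rpow_neg hx0.le]
        have : 0 < ‖x‖ ^ N := Real.rpow_pos_of_pos hx0 _
        field_simp
      have h5 : Y / ρ ^ N ≤ C := by rwa [div_le_iff₀ hρN]
      have h6 : ‖x‖ ^ (-N) * Y ≤ Y / ρ ^ N := by
        rw [div_eq_mul_inv, mul_comm, ← Real.rpow_neg hρ0.le]
        exact mul_le_mul_of_nonneg_left
          (Real.rpow_le_rpow_of_nonpos hρ0 h1.le (by linarith)) hY.le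
      nlinarith
    have hmono : (Y * ‖x‖ ^ (-N)) ^ p ≤ u x ^ p :=
      Real.rpow_le_rpow (by positivity) hlow (by positivity)
    -- Here the exponent is critical: Np = n, so f(u) and the source of the logarithmic barrier
    -- decay at the same rate.
    have hpow : (Y * ‖x‖ ^ (-N)) ^ p = Y ^ p * ‖x‖ ^ (-(n : ℝ)) := by
      rw [Real.mul_rpow hY.le hxN.le, ← Real.rpow_mul hx0.le]
      congr 2
      rw [hp]
      field_simp
    have hxn : 0 < ‖x‖ ^ (-(n : ℝ)) := Real.rpow_pos_of_pos hx0 _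
    have hκN : κ * N ≤ c / 2 * Y ^ p := by
      calc κ * N ≤ c / (2 * N) * Y ^ p * N := mul_le_mul_of_nonneg_right (min_le_left _ _) hN0.le
        _ = c / 2 * Y ^ p := by field_simp
    -- The factor 1/2 in the choice of κ makes the inequality strict, as the comparison principle
    -- requires.
    calc κ * N * ‖x‖ ^ (-(n : ℝ)) ≤ c / 2 * Y ^ p * ‖x‖ ^ (-(n : ℝ)) := by gcongr
      _ < c * (Y ^ p * ‖x‖ ^ (-(n : ℝ))) := by
        have : 0 < c * (Y ^ p * ‖x‖ ^ (-(n : ℝ))) := by positivity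
        linarith
      _ ≤ c * u x ^ p := by rw [← hpow]; gcongr
      _ ≤ f (u x) := hf _ hux hup

/-- The comparison principle is incompatible with a positive function on an exterior domain when `f`
dominates `s ^ (n / (n - 2))` on bounded intervals. -/
theorem not_positive [CountableInterFilter l] (hn : 3 ≤ n) (hR : 0 < R)
    (h : ComparisonPrinciple l f u R) (hf : ∀ s, 0 < s → 0 < f s)
    (hfp : ∀ C : ℝ, ∃ c : ℝ, 0 < c ∧ ∀ s, 0 < s → s ≤ C → c * s ^ ((n : ℝ) / ((n : ℝ) - 2)) ≤ f s)
    (hu : ∀ᶠ x in l, R < ‖x‖ → 0 < u x)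
    (hshell : ∀ a b, R < a → a < b → ∃ᶠ x in l, a < ‖x‖ ∧ ‖x‖ < b) {a b μ : ℝ} (ha : R < a)
    (hab : a < b) (hμ : 0 < μ) (hinit : ∀ᶠ x in l, a < ‖x‖ → ‖x‖ < b → μ ≤ u x) : False := by
  have hn' : (3 : ℝ) ≤ n := by exact_mod_cast hn
  have hN0 : 0 < (n : ℝ) - 2 := by linarith
  obtain ⟨Y₀, hY₀, hP₀⟩ := h.exists_fundamental_lower_bound hn hR hf ha hab hμ hu hinit
  obtain ⟨C, hC, hbound⟩ := h.exists_upper_bound hn hR hf hu hshell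
  set lam : ℝ := 2 * Real.exp 1 with hlam
  have hexp : (1 : ℝ) ≤ Real.exp 1 := Real.one_le_exp zero_le_one
  have hlam1 : 1 ≤ lam := by linarith
  set Λ : ℝ := lam ^ ((n : ℝ) - 2) with hΛ
  have hΛ1 : 1 ≤ Λ := Real.one_le_rpow hlam1 hN0.le
  -- The radii grow by `lam`, so the admissible coefficient grows by Λ per step; this K lets the
  -- actual coefficient grow by 2Λ.
  set K : ℝ := 2 * Λ - 1 with hK
  have hK0 : 0 < K := by linarith
  obtain ⟨c, hc, hfc⟩ := hfp ((1 + K) * C)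
  set ρ₀ : ℝ := max a (4 * R) with hρ₀
  have hρ₀R : 4 * R ≤ ρ₀ := le_max_right _ _
  have hρ₀0 : 0 < ρ₀ := by linarith
  let y : ℕ → ℝ := fun k => Nat.rec Y₀ (fun _ Y =>
    Y + min (c / (2 * ((n : ℝ) - 2)) * Y ^ ((n : ℝ) / ((n : ℝ) - 2))) (K * Y)) k
  have hy : ∀ k, y (k + 1) =
    y k + min (c / (2 * ((n : ℝ) - 2)) * y k ^ ((n : ℝ) / ((n : ℝ) - 2))) (K * y k) := fun k => rfl
  have hρk : ∀ k : ℕ, 4 * R ≤ lam ^ k * ρ₀ := fun k => by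
    have : 1 ≤ lam ^ k := one_le_pow₀ hlam1
    nlinarith
  have hall : ∀ k : ℕ, 0 < y k ∧
      ∀ᶠ x in l, lam ^ k * ρ₀ < ‖x‖ → y k * ‖x‖ ^ (-((n : ℝ) - 2)) ≤ u x := fun k => by
    induction k with
    | zero =>
      refine ⟨hY₀, ?_⟩
      filter_upwards [hP₀] with x hx h1
      rw [pow_zero, one_mul] at h1
      exact hx ((le_max_left _ _).trans_lt h1)
    | succ k ih =>
      have hyk := ih.1
      refine ⟨?_, ?_⟩
      · rw [hy]
        have : 0 ≤ min (c / (2 * ((n : ℝ) - 2)) * y k ^ ((n : ℝ) / ((n : ℝ) - 2))) (K * y k) :=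
          le_min (by positivity) (by positivity)
        linarith
      · have hb := h.improve_lower_bound hn hR (by linarith [hρk k]) ih.1 hK0.le hu
          (hbound _ _ (hρk k) ih.1 ih.2) hc hfc ih.2
        rw [hy, pow_succ']
        simpa only [hlam, mul_assoc] using hb
  refine not_geometric_bound_of_superlinear_growth (y := y) (c := c / (2 * ((n : ℝ) - 2)))
    (p := (n : ℝ) / ((n : ℝ) - 2)) (K := K) (Λ := Λ) (A := C * ρ₀ ^ ((n : ℝ) - 2)) (by positivity)
    ?_ hΛ1 (by rw [hK]; ring) hY₀ (fun k => (hy k).ge) fun k => ?_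
  · rw [one_lt_div hN0]
    linarith
  · refine (hbound _ _ (hρk k) (hall k).1 (hall k).2).trans_eq ?_
    rw [Real.mul_rpow (by positivity) hρ₀0.le, hΛ, ← Real.rpow_natCast, ← Real.rpow_natCast,
      ← Real.rpow_mul (by positivity), ← Real.rpow_mul (by positivity), mul_comm (k : ℝ)]
    ring

end ComparisonPrinciple

/-! ### Exterior domains, shells, and the viscosity case. -/

theorem IsExteriorDomain.exists_radius {n : ℕ} {Ω : Set (EuclideanSpace ℝ (Fin n))}
    (hΩ : IsExteriorDomain Ω) : ∃ R : ℝ, 0 < R ∧ ∀ x, R < ‖x‖ → x ∈ Ω := by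
  obtain ⟨r, hr⟩ := hΩ.2.2.exists_norm_le
  refine ⟨max r 1, by positivity, fun x hx => ?_⟩
  by_contra hcon
  exact ((le_max_left r 1).trans_lt hx).not_ge (hr x hcon)

/-- The closed annulus `a ≤ |x| ≤ b` of `ℝⁿ`. -/
def closedShell (n : ℕ) (a b : ℝ) : Set (EuclideanSpace ℝ (Fin n)) :=
  {x | a ≤ ‖x‖ ∧ ‖x‖ ≤ b}

theorem isCompact_closedShell {n : ℕ} (a b : ℝ) : IsCompact (closedShell n a b) := by
  refine Metric.isCompact_of_isClosed_isBounded
    ((isClosed_le continuous_const continuous_norm).inter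
      (isClosed_le continuous_norm continuous_const)) ?_
  exact (Metric.isBounded_closedBall (x := 0) (r := b)).subset fun x hx => by
    simpa using hx.2

theorem exists_norm_eq_of_pos {n : ℕ} (hn : 0 < n) {r : ℝ} (hr : 0 ≤ r) :
    ∃ x : EuclideanSpace ℝ (Fin n), ‖x‖ = r :=
  ⟨EuclideanSpace.single ⟨0, hn⟩ r, by simp [abs_of_nonneg hr]⟩

/-- Viscosity supersolutions satisfy the pointwise comparison principle. -/
theorem IsViscositySupersolution.comparisonPrinciple {n : ℕ} {f : ℝ → ℝ}
    {Ω : Set (EuclideanSpace ℝ (Fin n))} {u : EuclideanSpace ℝ (Fin n) → ℝ}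
    (hu : IsViscositySupersolution f Ω u) {R : ℝ} (hR : ∀ x, R < ‖x‖ → x ∈ Ω) :
    ComparisonPrinciple ⊤ f u R := by
  intro a b η φ ha hη hφ hbd hsub
  simp only [Filter.eventually_top] at hbd hsub ⊢
  intro z hza hzb
  by_contra hcon
  push Not at hcon
  have hz : ¬(‖z‖ < a + η ∨ b - η < ‖z‖) := fun h => (hbd z hza hzb h).not_gt hcon
  push Not at hz
  set S := closedShell n (a + η / 2) (b - η / 2) with hS
  have hSΩ : S ⊆ Ω := fun x hx => hR x (by linarith [hx.1])
  have hlsc : LowerSemicontinuousOn (fun x => u x + -φ x) S :=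
    (hu.1.mono hSΩ).add hφ.neg.continuous.continuousOn.lowerSemicontinuousOn
  have hzS : z ∈ S := ⟨by linarith, by linarith⟩
  obtain ⟨x₀, hx₀, hmin⟩ := hlsc.exists_isMinOn ⟨z, hzS⟩ (isCompact_closedShell _ _)
  have hneg : u x₀ < φ x₀ := by
    have : u x₀ + -φ x₀ ≤ u z + -φ z := hmin hzS
    linarith
  have hx₀a : a < ‖x₀‖ := by linarith [hx₀.1]
  have hx₀b : ‖x₀‖ < b := by linarith [hx₀.2]
  have hint : ¬(‖x₀‖ < a + η ∨ b - η < ‖x₀‖) := fun h => (hbd x₀ hx₀a hx₀b h).not_gt hneg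
  push Not at hint
  have hnhds : S ∈ 𝓝 x₀ := by
    have h1 := continuous_norm.continuousAt.eventually (lt_mem_nhds (show a + η / 2 < ‖x₀‖ by linarith))
    have h2 := continuous_norm.continuousAt.eventually (gt_mem_nhds (show ‖x₀‖ < b - η / 2 by linarith))
    filter_upwards [h1, h2] with x h1 h2
    exact ⟨h1.le, h2.le⟩
  have hloc : IsLocalMinOn (fun x => u x - φ x) Ω x₀ := by
    refine IsLocalMin.on ?_ Ω
    filter_upwards [hnhds] with x hx
    have : u x₀ + -φ x₀ ≤ u x + -φ x := hmin hx
    linarith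
  have hvis := hu.2 x₀ (hSΩ hx₀) φ ((contDiff_infty.1 hφ 2).contDiffOn) hloc
  exact (hsub x₀ hx₀a hx₀b hneg).not_ge hvis

/-- There is no positive viscosity supersolution in an exterior domain. -/
theorem IsViscositySupersolution.not_positive {n : ℕ} (hn : 3 ≤ n) {f : ℝ → ℝ}
    (hf : ∀ s, 0 < s → 0 < f s)
    (hfp : ∀ C : ℝ, ∃ c : ℝ, 0 < c ∧ ∀ s, 0 < s → s ≤ C → c * s ^ ((n : ℝ) / ((n : ℝ) - 2)) ≤ f s)
    {Ω : Set (EuclideanSpace ℝ (Fin n))} (hΩ : IsExteriorDomain Ω) {u : EuclideanSpace ℝ (Fin n) → ℝ}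
    (hpos : ∀ x ∈ Ω, 0 < u x) (hu : IsViscositySupersolution f Ω u) : False := by
  obtain ⟨R, hR0, hR⟩ := hΩ.exists_radius
  set S := closedShell n (2 * R) (3 * R) with hS
  have hSΩ : S ⊆ Ω := fun x hx => hR x (by linarith [hx.1])
  obtain ⟨z, hz⟩ := exists_norm_eq_of_pos (n := n) (by omega) (show 0 ≤ 2 * R by linarith)
  -- A lower semicontinuous function attains its minimum on a compact shell; this positive value
  -- starts the iteration.
  obtain ⟨x₀, hx₀, hmin⟩ := (hu.1.mono hSΩ).exists_isMinOn
    ⟨z, show z ∈ S from ⟨hz.ge, by linarith⟩⟩ (isCompact_closedShell _ _)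
  refine (hu.comparisonPrinciple hR).not_positive hn hR0 hf hfp ?_ ?_
    (a := 2 * R) (b := 3 * R) (by linarith) (by linarith) (hpos x₀ (hSΩ hx₀)) ?_
  · exact Filter.eventually_top.2 fun x hx => hpos x (hR x hx)
  · intro a b ha hab
    obtain ⟨y, hy⟩ := exists_norm_eq_of_pos (n := n) (by omega) (show 0 ≤ (a + b) / 2 by linarith)
    rw [Filter.frequently_top]
    exact ⟨y, by rw [hy]; constructor <;> linarith⟩
  · exact Filter.eventually_top.2 fun x h1 h2 => hmin ⟨h1.le, h2.le⟩

/-! ### Laplacians of mollifications, Green's identity, convex compositions. -/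

section DirectionalDerivatives

variable {n : ℕ}

theorem ContDiff.fderiv_apply_const {k : EuclideanSpace ℝ (Fin n) → ℝ} (hk : ContDiff ℝ ∞ k)
    (v : EuclideanSpace ℝ (Fin n)) : ContDiff ℝ ∞ fun y => fderiv ℝ k y v :=
  (hk.fderiv_right (m := ∞) (by simp)).clm_apply contDiff_const

theorem HasCompactSupport.fderiv_fderiv_apply {k : EuclideanSpace ℝ (Fin n) → ℝ}
    (hk : HasCompactSupport k) (v : EuclideanSpace ℝ (Fin n)) :
    HasCompactSupport fun y => fderiv ℝ (fun y => fderiv ℝ k y v) y v :=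
  (hk.fderiv_apply ℝ v).fderiv_apply ℝ v

theorem fderiv_comp_const_sub_apply {k : EuclideanSpace ℝ (Fin n) → ℝ} (hk : Differentiable ℝ k)
    (x y v : EuclideanSpace ℝ (Fin n)) :
    fderiv ℝ (fun y => k (x - y)) y v = -(fderiv ℝ k (x - y) v) := by
  have h1 : HasFDerivAt (fun y : EuclideanSpace ℝ (Fin n) => x - y)
      (-(ContinuousLinearMap.id ℝ (EuclideanSpace ℝ (Fin n)))) y := by
    simpa using (hasFDerivAt_id y).const_sub x
  have h2 : HasFDerivAt (fun y => k (x - y)) _ y := ((hk (x - y)).hasFDerivAt).comp y h1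
  rw [h2.fderiv]
  simp

theorem ContDiff.laplacian_eq {k : EuclideanSpace ℝ (Fin n) → ℝ} (hk : ContDiff ℝ 2 k) :
    Laplacian.laplacian k = fun x => ∑ i, fderiv ℝ
      (fun y => fderiv ℝ k y (EuclideanSpace.basisFun (Fin n) ℝ i)) x
      (EuclideanSpace.basisFun (Fin n) ℝ i) :=
  funext fun _ => laplacian_eq_sum_fderiv_fderiv hk.contDiffAt

theorem ContDiff.continuous_laplacian {k : EuclideanSpace ℝ (Fin n) → ℝ} (hk : ContDiff ℝ 2 k) :
    Continuous (Laplacian.laplacian k) := by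
  rw [hk.laplacian_eq]
  refine continuous_finsetSum _ fun i _ => ?_
  have h1 : ContDiff ℝ 1 fun y => fderiv ℝ k y (EuclideanSpace.basisFun (Fin n) ℝ i) :=
    (hk.fderiv_right (m := 1) (by norm_num)).clm_apply contDiff_const
  exact (h1.continuous_fderiv (by norm_num)).clm_apply continuous_const

theorem laplacian_eq_zero_of_notMem_tsupport {k : EuclideanSpace ℝ (Fin n) → ℝ}
    {x : EuclideanSpace ℝ (Fin n)} (hx : x ∉ tsupport k) : Laplacian.laplacian k x = 0 := by
  rw [notMem_tsupport_iff_eventuallyEq] at hx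
  have h := InnerProductSpace.laplacian_congr_nhds (f₂ := fun _ => (0 : ℝ)) hx
  rw [h.eq_of_nhds]
  simp

theorem HasCompactSupport.laplacian {k : EuclideanSpace ℝ (Fin n) → ℝ}
    (hk : HasCompactSupport k) : HasCompactSupport (Laplacian.laplacian k) :=
  HasCompactSupport.intro hk fun _ hx => laplacian_eq_zero_of_notMem_tsupport hx

theorem laplacian_comp_const_sub {k : EuclideanSpace ℝ (Fin n) → ℝ} (hk : ContDiff ℝ ∞ k)
    (x y : EuclideanSpace ℝ (Fin n)) :
    Laplacian.laplacian (fun y => k (x - y)) y = Laplacian.laplacian k (x - y) := by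
  have hk2 := contDiff_infty.1 hk 2
  have hkc : ContDiff ℝ 2 fun y => k (x - y) := hk2.comp (contDiff_const.sub contDiff_id)
  rw [hkc.laplacian_eq, hk2.laplacian_eq]
  refine Finset.sum_congr rfl fun i _ => ?_
  set e := EuclideanSpace.basisFun (Fin n) ℝ i
  have h1 : (fun y => fderiv ℝ (fun y => k (x - y)) y e) = fun y => -(fderiv ℝ k (x - y) e) :=
    funext fun y => fderiv_comp_const_sub_apply (hk.differentiable (by simp)) x y e
  rw [h1, fderiv_fun_neg, neg_apply,
    fderiv_comp_const_sub_apply (k := fun y => fderiv ℝ k y e)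
      ((hk.fderiv_apply_const e).differentiable (by simp)) x y e, neg_neg]

open MeasureTheory in
theorem fderiv_convolution_apply {k v : EuclideanSpace ℝ (Fin n) → ℝ} (hk : ContDiff ℝ ∞ k)
    (hkc : HasCompactSupport k) (hv : LocallyIntegrable v volume) (x e : EuclideanSpace ℝ (Fin n)) :
    fderiv ℝ (convolution k v (ContinuousLinearMap.lsmul ℝ ℝ) volume) x e =
      convolution (fun y => fderiv ℝ k y e) v (ContinuousLinearMap.lsmul ℝ ℝ) volume x := by
  rw [(hkc.hasFDerivAt_convolution_left (ContinuousLinearMap.lsmul ℝ ℝ)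
    (contDiff_infty.1 hk 1) hv x).fderiv, convolution_def, convolution_def]
  have hint := (hkc.fderiv ℝ).convolutionExists_left
    (ContinuousLinearMap.precompL (EuclideanSpace ℝ (Fin n)) (ContinuousLinearMap.lsmul ℝ ℝ))
    (hk.continuous_fderiv (by simp)) hv x
  rw [ContinuousLinearMap.integral_apply hint]
  rfl

open MeasureTheory in
/-- The Laplacian of a mollification. -/
theorem laplacian_convolution {k v : EuclideanSpace ℝ (Fin n) → ℝ} (hk : ContDiff ℝ ∞ k)
    (hkc : HasCompactSupport k) (hv : LocallyIntegrable v volume) (x : EuclideanSpace ℝ (Fin n)) :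
    Laplacian.laplacian (convolution k v (ContinuousLinearMap.lsmul ℝ ℝ) volume) x =
      ∫ y, Laplacian.laplacian (fun y => k (x - y)) y * v y := by
  have hconv : ContDiff ℝ 2 (convolution k v (ContinuousLinearMap.lsmul ℝ ℝ) volume) :=
    hkc.contDiff_convolution_left _ (n := 2) (contDiff_infty.1 hk 2) hv
  have hk2 := contDiff_infty.1 hk 2
  simp_rw [laplacian_comp_const_sub hk]
  rw [hconv.laplacian_eq, hk2.laplacian_eq]
  have h1 : ∀ e : EuclideanSpace ℝ (Fin n),
      (fun y => fderiv ℝ (convolution k v (ContinuousLinearMap.lsmul ℝ ℝ) volume) y e) =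
      convolution (fun y => fderiv ℝ k y e) v (ContinuousLinearMap.lsmul ℝ ℝ) volume :=
    fun e => funext fun y => fderiv_convolution_apply hk hkc hv y e
  simp_rw [h1, fun e => fderiv_convolution_apply (hk.fderiv_apply_const e) (hkc.fderiv_apply ℝ e) hv x e,
    convolution_eq_swap, Finset.sum_mul]
  rw [integral_finsetSum]
  · rfl
  · intro i _
    set e := EuclideanSpace.basisFun (Fin n) ℝ i
    have h2 := ((hkc.fderiv_apply ℝ e).fderiv_apply ℝ e).convolutionExists_left
      (ContinuousLinearMap.lsmul ℝ ℝ)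
      ((hk.fderiv_apply_const e).fderiv_apply_const e).continuous hv x
    exact h2.integrable_swap

open MeasureTheory in
/-- Green's identity for a compactly supported function. -/
theorem integral_mul_laplacian_eq {F ψ : EuclideanSpace ℝ (Fin n) → ℝ} (hF : ContDiff ℝ 2 F)
    (hψ : ContDiff ℝ ∞ ψ) (hψc : HasCompactSupport ψ) :
    ∫ x, F x * Laplacian.laplacian ψ x = ∫ x, Laplacian.laplacian F x * ψ x := by
  have hψ2 := contDiff_infty.1 hψ 2
  rw [hF.laplacian_eq, hψ2.laplacian_eq]
  simp_rw [Finset.mul_sum, Finset.sum_mul]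
  have hF1 : ∀ e : EuclideanSpace ℝ (Fin n), ContDiff ℝ 1 fun y => fderiv ℝ F y e := fun e =>
    (hF.fderiv_right (m := 1) (by norm_num)).clm_apply contDiff_const
  have hF2 : ∀ e : EuclideanSpace ℝ (Fin n),
      Continuous fun x => fderiv ℝ (fun y => fderiv ℝ F y e) x e := fun e =>
    ((hF1 e).continuous_fderiv (by norm_num)).clm_apply continuous_const
  have hψ1 : ∀ e : EuclideanSpace ℝ (Fin n), ContDiff ℝ ∞ fun y => fderiv ℝ ψ y e :=
    fun e => hψ.fderiv_apply_const e
  have i1 : ∀ e : EuclideanSpace ℝ (Fin n),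
      Integrable fun x => F x * fderiv ℝ (fun y => fderiv ℝ ψ y e) x e := fun e =>
    (hF.continuous.mul ((hψ1 e).fderiv_apply_const e).continuous).integrable_of_hasCompactSupport
      (hψc.fderiv_fderiv_apply e).mul_left
  have i2 : ∀ e : EuclideanSpace ℝ (Fin n),
      Integrable fun x => fderiv ℝ F x e * fderiv ℝ ψ x e := fun e =>
    ((hF1 e).continuous.mul (hψ1 e).continuous).integrable_of_hasCompactSupport
      (hψc.fderiv_apply ℝ e).mul_left
  have i3 : ∀ e : EuclideanSpace ℝ (Fin n),
      Integrable fun x => fderiv ℝ (fun y => fderiv ℝ F y e) x e * ψ x := fun e =>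
    ((hF2 e).mul hψ.continuous).integrable_of_hasCompactSupport hψc.mul_left
  have i4 : ∀ e : EuclideanSpace ℝ (Fin n), Integrable fun x => F x * fderiv ℝ ψ x e := fun e =>
    (hF.continuous.mul (hψ1 e).continuous).integrable_of_hasCompactSupport
      (hψc.fderiv_apply ℝ e).mul_left
  have i5 : ∀ e : EuclideanSpace ℝ (Fin n), Integrable fun x => fderiv ℝ F x e * ψ x := fun e =>
    ((hF1 e).continuous.mul hψ.continuous).integrable_of_hasCompactSupport hψc.mul_left
  rw [integral_finsetSum _ fun i _ => i1 _, integral_finsetSum _ fun i _ => i3 _]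
  refine Finset.sum_congr rfl fun i _ => ?_
  set e := EuclideanSpace.basisFun (Fin n) ℝ i
  have hFd : Differentiable ℝ F := hF.differentiable (by norm_num)
  rw [integral_mul_fderiv_eq_neg_fderiv_mul_of_integrable (i2 e) (i1 e) (i4 e) (fun x _ => hFd x)
      (fun x _ => ((hψ1 e).differentiable (by simp)) x),
    integral_mul_fderiv_eq_neg_fderiv_mul_of_integrable (i3 e) (i2 e) (i5 e)
      (fun x _ => ((hF1 e).differentiable (by norm_num)) x)
      (fun x _ => (hψ.differentiable (by simp)) x), neg_neg]

/-- The Laplacian of a convex function of `w`. -/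
theorem le_laplacian_comp {H H' H'' : ℝ → ℝ} {w : EuclideanSpace ℝ (Fin n) → ℝ}
    (hHc : ContDiff ℝ 2 H) (hH : ∀ s, HasDerivAt H (H' s) s) (hH' : ∀ s, HasDerivAt H' (H'' s) s)
    (hH'' : ∀ s, 0 ≤ H'' s) (hw : ContDiff ℝ 2 w) (x : EuclideanSpace ℝ (Fin n)) :
    H' (w x) * Laplacian.laplacian w x ≤ Laplacian.laplacian (fun y => H (w y)) x := by
  have hc : ContDiff ℝ 2 fun y => H (w y) := hHc.comp hw
  rw [hc.laplacian_eq, hw.laplacian_eq, Finset.mul_sum]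
  refine Finset.sum_le_sum fun i _ => ?_
  set e := EuclideanSpace.basisFun (Fin n) ℝ i
  have hwd : Differentiable ℝ w := hw.differentiable (by norm_num)
  have hwd1 : Differentiable ℝ fun y => fderiv ℝ w y e :=
    ((hw.fderiv_right (m := 1) (by norm_num)).clm_apply contDiff_const).differentiable (by norm_num)
  have h1 : (fun y => fderiv ℝ (fun y => H (w y)) y e) = fun y => H' (w y) * fderiv ℝ w y e := by
    funext y
    have h2 : HasFDerivAt (fun y => H (w y)) _ y := (hH (w y)).comp_hasFDerivAt y (hwd y).hasFDerivAt
    rw [h2.fderiv]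
    simp
  have h3 : HasFDerivAt (fun y => H' (w y)) _ x := (hH' (w x)).comp_hasFDerivAt x (hwd x).hasFDerivAt
  have h4 : HasFDerivAt (fun y => H' (w y) * fderiv ℝ w y e) _ x := h3.mul (hwd1 x).hasFDerivAt
  rw [h1, h4.fderiv]
  simp only [add_apply, smul_apply, smul_eq_mul]
  -- The discarded term is H''(w)(∂_e w)², nonnegative by convexity.
  nlinarith [mul_nonneg (hH'' (w x)) (sq_nonneg (fderiv ℝ w x e))]

end DirectionalDerivatives

/-! ### A convex `C²` truncation. -/

section CubedNegativePart

/-- Away from 0 the function is locally a polynomial. At 0 it is O(s^(m+2)), hence o(s), which is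
why the exponent starts at 2. -/
theorem hasDerivAt_max_neg_zero_pow (m : ℕ) (s : ℝ) :
    HasDerivAt (fun s : ℝ => max (-s) 0 ^ (m + 2)) (-((m + 2 : ℝ) * max (-s) 0 ^ (m + 1))) s := by
  rcases lt_trichotomy s 0 with hs | hs | hs
  · have h : HasDerivAt (fun s : ℝ => (-s) ^ (m + 2)) (-((m + 2 : ℝ) * (-s) ^ (m + 1))) s := by
      have := (hasDerivAt_id s).neg.pow (m + 2)
      refine this.congr_deriv ?_
      simp
    rw [max_eq_left (by linarith)]
    refine h.congr_of_eventuallyEq ?_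
    filter_upwards [gt_mem_nhds hs] with t ht
    rw [max_eq_left (by linarith)]
  · subst hs
    rw [hasDerivAt_iff_isLittleO]
    simp only [neg_zero, max_self, ne_eq, Nat.add_eq_zero_iff, one_ne_zero, and_false,
      not_false_eq_true, zero_pow, mul_zero, neg_zero, smul_zero, sub_zero, OfNat.ofNat_ne_zero]
    have h1 : (fun s : ℝ => max (-s) 0 ^ (m + 2)) =O[𝓝 0] fun s : ℝ => s ^ (m + 2) := by
      refine Asymptotics.IsBigO.of_bound 1 (Filter.Eventually.of_forall fun t => ?_)
      rw [norm_pow, norm_pow, one_mul]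
      refine pow_le_pow_left₀ (norm_nonneg _) ?_ _
      rw [Real.norm_of_nonneg (le_max_right _ _)]
      exact max_le (neg_le_abs t) (abs_nonneg t)
    exact h1.trans_isLittleO (by
      simpa using Asymptotics.isLittleO_pow_pow (𝕜 := ℝ) (show 1 < m + 2 by omega))
  · rw [max_eq_right (by linarith)]
    simp only [ne_eq, Nat.add_eq_zero_iff, one_ne_zero, and_false, not_false_eq_true, zero_pow,
      mul_zero, neg_zero]
    refine (hasDerivAt_const s (0 : ℝ)).congr_of_eventuallyEq ?_
    filter_upwards [lt_mem_nhds hs] with t ht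
    rw [max_eq_right (by linarith)]
    simp

/-- The cube is the smallest integer power of the negative part that is `C²`, so its composition
with a mollification has a classical Laplacian. -/
theorem contDiff_max_neg_zero_cubed : ContDiff ℝ 2 fun s : ℝ => max (-s) 0 ^ 3 := by
  have h1 : ∀ m : ℕ, deriv (fun s : ℝ => max (-s) 0 ^ (m + 2)) =
      fun s => -((m + 2 : ℝ) * max (-s) 0 ^ (m + 1)) := fun m =>
    funext fun s => (hasDerivAt_max_neg_zero_pow m s).deriv
  have h2 : ContDiff ℝ 1 fun s : ℝ => max (-s) 0 ^ 2 := by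
    rw [contDiff_one_iff_deriv, h1 0]
    exact ⟨fun s => (hasDerivAt_max_neg_zero_pow 0 s).differentiableAt, by fun_prop⟩
  rw [show (2 : WithTop ℕ∞) = 1 + 1 by norm_num, contDiff_succ_iff_deriv, h1 1]
  exact ⟨fun s => (hasDerivAt_max_neg_zero_pow 1 s).differentiableAt, by simp,
    (contDiff_const.mul h2).neg⟩

end CubedNegativePart

/-! ### Distributional supersolutions, their mollification, and the weak formulation. -/

/-- `-Δu ≥ G` in the sense of distributions in `{|x| > R}`, with `u` and `G` locally integrable. -/
structure IsExteriorDistributionalSupersolution {n : ℕ} (R : ℝ)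
    (u G : EuclideanSpace ℝ (Fin n) → ℝ) : Prop where
  integrableOn_left : ∀ a b, R < a → MeasureTheory.IntegrableOn u (closedShell n a b)
  integrableOn_right : ∀ a b, R < a → MeasureTheory.IntegrableOn G (closedShell n a b)
  integral_le : ∀ φ, IsTestFunction {x : EuclideanSpace ℝ (Fin n) | R < ‖x‖} φ → (∀ x, 0 ≤ φ x) →
    ∫ x, G x * φ x ≤ -∫ x, u x * Laplacian.laplacian φ x

/-- A smooth radial cutoff function of a shell. -/
theorem exists_radial_cutoff {n : ℕ} {a₁ a₂ b₁ b₂ : ℝ} (ha₁ : 0 < a₁) (ha : a₁ < a₂) (hb₂ : 0 < b₂)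
    (hb : b₂ < b₁) :
    ∃ χ : EuclideanSpace ℝ (Fin n) → ℝ, ContDiff ℝ ∞ χ ∧ (∀ x, 0 ≤ χ x) ∧
      (∀ x, a₂ ≤ ‖x‖ → ‖x‖ ≤ b₂ → χ x = 1) ∧ tsupport χ ⊆ closedShell n a₁ b₁ := by
  have hd : 0 < a₂ ^ 2 - a₁ ^ 2 := by nlinarith
  have he : 0 < b₁ ^ 2 - b₂ ^ 2 := by nlinarith
  refine ⟨fun x => Real.smoothTransition ((‖x‖ ^ 2 - a₁ ^ 2) / (a₂ ^ 2 - a₁ ^ 2)) *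
    Real.smoothTransition ((b₁ ^ 2 - ‖x‖ ^ 2) / (b₁ ^ 2 - b₂ ^ 2)), ?_, fun x => ?_, fun x h1 h2 => ?_, ?_⟩
  · have hsq : ContDiff ℝ ∞ fun x : EuclideanSpace ℝ (Fin n) => ‖x‖ ^ 2 := contDiff_norm_sq ℝ
    exact (Real.smoothTransition.contDiff.comp ((hsq.sub contDiff_const).div_const _)).mul
      (Real.smoothTransition.contDiff.comp ((contDiff_const.sub hsq).div_const _))
  · exact mul_nonneg (Real.smoothTransition.nonneg _) (Real.smoothTransition.nonneg _)
  · have h3 : 0 ≤ ‖x‖ := norm_nonneg x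
    dsimp only
    rw [Real.smoothTransition.one_of_one_le, Real.smoothTransition.one_of_one_le, one_mul]
    · rw [one_le_div he]
      nlinarith
    · rw [one_le_div hd]
      nlinarith
  · refine closure_minimal (fun x hx => ?_) (isCompact_closedShell _ _).isClosed
    have h3 : 0 ≤ ‖x‖ := norm_nonneg x
    rw [Function.mem_support] at hx
    constructor
    · by_contra hcon
      push Not at hcon
      refine hx ?_
      rw [Real.smoothTransition.zero_of_nonpos, zero_mul]
      exact div_nonpos_of_nonpos_of_nonneg (by nlinarith) hd.le
    · by_contra hcon
      push Not at hcon
      refine hx ?_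
      rw [Real.smoothTransition.zero_of_nonpos (x := (b₁ ^ 2 - ‖x‖ ^ 2) / _), mul_zero]
      exact div_nonpos_of_nonpos_of_nonneg (by nlinarith) he.le

section WeakFormulation

variable {n : ℕ} {Ω : Set (EuclideanSpace ℝ (Fin n))}

theorem MemL2Loc.integrableOn {F : Type*} [NormedAddCommGroup F] {w : EuclideanSpace ℝ (Fin n) → F}
    (hw : MemL2Loc Ω w) {K : Set (EuclideanSpace ℝ (Fin n))} (hK : IsCompact K) (hKΩ : K ⊆ Ω) :
    MeasureTheory.IntegrableOn w K := by
  have : MeasureTheory.IsFiniteMeasure (MeasureTheory.volume.restrict K) :=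
    ⟨by rw [MeasureTheory.Measure.restrict_apply_univ]; exact hK.measure_lt_top⟩
  exact (hw K hK hKΩ).integrable one_le_two

theorem IsTestFunction.fderiv_apply {φ : EuclideanSpace ℝ (Fin n) → ℝ} (hφ : IsTestFunction Ω φ)
    (v : EuclideanSpace ℝ (Fin n)) : IsTestFunction Ω fun y => fderiv ℝ φ y v :=
  ⟨hφ.1.fderiv_apply_const v, hφ.2.1.fderiv_apply ℝ v, (tsupport_fderiv_apply_subset ℝ v).trans hφ.2.2⟩

theorem MemL2Loc.integrable_smul {F : Type*} [NormedAddCommGroup F] [NormedSpace ℝ F]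
    {w : EuclideanSpace ℝ (Fin n) → F} (hw : MemL2Loc Ω w) {k : EuclideanSpace ℝ (Fin n) → ℝ}
    (hk : Continuous k) (hkc : HasCompactSupport k) (hkΩ : tsupport k ⊆ Ω) :
    MeasureTheory.Integrable fun x => k x • w x := by
  rw [← MeasureTheory.integrableOn_iff_integrable_of_support_subset (s := tsupport k)]
  · exact (hw.integrableOn hkc hkΩ).continuousOn_smul hk.continuousOn hkc
  · intro x hx
    refine subset_tsupport k (Function.mem_support.2 fun h => hx ?_)
    simp [h]

theorem MemL2Loc.integrable_smul_right {F : Type*} [NormedAddCommGroup F] [NormedSpace ℝ F]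
    [SecondCountableTopology F]
    {w : EuclideanSpace ℝ (Fin n) → ℝ} (hw : MemL2Loc Ω w) {k : EuclideanSpace ℝ (Fin n) → F}
    (hk : Continuous k) (hkc : HasCompactSupport k) (hkΩ : tsupport k ⊆ Ω) :
    MeasureTheory.Integrable fun x => w x • k x := by
  rw [← MeasureTheory.integrableOn_iff_integrable_of_support_subset (s := tsupport k)]
  · exact (hw.integrableOn hkc hkΩ).smul_continuousOn hk.continuousOn hkc
  · intro x hx
    refine subset_tsupport k (Function.mem_support.2 fun h => hx ?_)
    simp [h]

theorem inner_gradient_eq_fderiv {k : EuclideanSpace ℝ (Fin n) → ℝ} (x v : EuclideanSpace ℝ (Fin n)) :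
    ⟪v, ∇ k x⟫_ℝ = fderiv ℝ k x v := by
  rw [real_inner_comm]
  exact inner_gradient_left

open MeasureTheory in
/-- Integration by parts of the weak gradient against a test function. -/
theorem IsWeakGradient.integral_inner_gradient {u : EuclideanSpace ℝ (Fin n) → ℝ}
    {g : EuclideanSpace ℝ (Fin n) → EuclideanSpace ℝ (Fin n)} (hu : MemL2Loc Ω u)
    (hg : MemL2Loc Ω g) (hug : IsWeakGradient Ω u g) {φ : EuclideanSpace ℝ (Fin n) → ℝ}
    (hφ : IsTestFunction Ω φ) :
    ∫ x in Ω, ⟪g x, ∇ φ x⟫_ℝ = -∫ x in Ω, u x * Laplacian.laplacian φ x := by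
  set b := EuclideanSpace.basisFun (Fin n) ℝ with hb
  have hφ2 := contDiff_infty.1 hφ.1 2
  have h1 : ∀ x, ⟪g x, ∇ φ x⟫_ℝ = ∑ i, ⟪b i, fderiv ℝ φ x (b i) • g x⟫_ℝ := fun x => by
    rw [← b.sum_inner_mul_inner]
    refine Finset.sum_congr rfl fun i _ => ?_
    rw [inner_gradient_eq_fderiv, inner_smul_right, real_inner_comm, mul_comm]
  have hgrad : ∀ i, Continuous (∇ fun y => fderiv ℝ φ y (b i)) ∧
      HasCompactSupport (∇ fun y => fderiv ℝ φ y (b i)) ∧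
      tsupport (∇ fun y => fderiv ℝ φ y (b i)) ⊆ Ω := fun i => by
    have ht := hφ.fderiv_apply (b i)
    have heq : (∇ fun y => fderiv ℝ φ y (b i)) = (InnerProductSpace.toDual ℝ
      (EuclideanSpace ℝ (Fin n))).symm ∘ fderiv ℝ (fun y => fderiv ℝ φ y (b i)) := rfl
    rw [heq]
    refine ⟨(LinearIsometryEquiv.continuous _).comp (ht.1.continuous_fderiv (by simp)),
      (ht.2.1.fderiv ℝ).comp_left (by simp), ?_⟩
    exact ((tsupport_comp_subset (by simp) _).trans (tsupport_fderiv_subset ℝ)).trans ht.2.2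
  -- The weak gradient identity is applied to the test function ∂_i φ, and its i-th component is
  -- taken.
  have h2 : ∀ i, ∫ x in Ω, ⟪b i, fderiv ℝ φ x (b i) • g x⟫_ℝ =
      -∫ x in Ω, u x * fderiv ℝ (fun y => fderiv ℝ φ y (b i)) x (b i) := fun i => by
    have ht := hφ.fderiv_apply (b i)
    rw [integral_inner (hg.integrable_smul ht.1.continuous ht.2.1 ht.2.2).integrableOn,
      ← neg_neg (∫ x in Ω, fderiv ℝ φ x (b i) • g x), ← hug _ ht, inner_neg_right,
      ← integral_inner (hu.integrable_smul_right (hgrad i).1 (hgrad i).2.1 (hgrad i).2.2).integrableOn]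
    simp_rw [inner_smul_right, inner_gradient_eq_fderiv]
  have h3 : ∀ i, IntegrableOn (fun x => u x * fderiv ℝ (fun y => fderiv ℝ φ y (b i)) x (b i)) Ω :=
    fun i => by
    have ht := (hφ.fderiv_apply (b i)).fderiv_apply (b i)
    exact (hu.integrable_smul_right ht.1.continuous ht.2.1 ht.2.2).integrableOn
  simp_rw [h1]
  rw [integral_finsetSum, Finset.sum_congr rfl fun i _ => h2 i, Finset.sum_neg_distrib,
    ← integral_finsetSum _ fun i _ => h3 i]
  · rw [hφ2.laplacian_eq]
    simp_rw [Finset.mul_sum]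
    rfl
  · intro i _
    have ht := hφ.fderiv_apply (b i)
    exact ((hg.integrable_smul ht.1.continuous ht.2.1 ht.2.2).const_inner (b i)).integrableOn

open MeasureTheory in
/-- Weak supersolutions are distributional supersolutions. -/
theorem IsWeakSupersolution.isExteriorDistributionalSupersolution {f : ℝ → ℝ}
    {u : EuclideanSpace ℝ (Fin n) → ℝ} (hu : IsWeakSupersolution f Ω u) {R : ℝ} (hR0 : 0 < R)
    (hR : ∀ x, R < ‖x‖ → x ∈ Ω) :
    IsExteriorDistributionalSupersolution R u fun x => f (u x) := by
  obtain ⟨hu2, g, hg2, hug, hineq⟩ := hu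
  have htest : ∀ φ, IsTestFunction {x : EuclideanSpace ℝ (Fin n) | R < ‖x‖} φ → IsTestFunction Ω φ :=
    fun φ hφ => ⟨hφ.1, hφ.2.1, hφ.2.2.trans hR⟩
  refine ⟨fun a b ha => ?_, fun a b ha => ?_, fun φ hφ hφ0 => ?_⟩
  · exact hu2.integrableOn (isCompact_closedShell a b) fun x hx => hR x (ha.trans_le hx.1)
  · obtain ⟨χ, hχ, hχ0, hχ1, hχs⟩ := exists_radial_cutoff (n := n) (a₁ := (a + R) / 2) (a₂ := a)
      (b₁ := max b 1 + 1) (b₂ := max b 1) (by linarith) (by linarith) (by positivity) (by linarith)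
    have ht : IsTestFunction Ω χ := by
      refine ⟨hχ, (isCompact_closedShell _ _).of_isClosed_subset (isClosed_tsupport _) hχs, ?_⟩
      exact hχs.trans fun x hx => hR x (by linarith [hx.1])
    have hint := (hineq χ ht hχ0).1.mono_set
      (show closedShell n a b ⊆ Ω from fun x hx => hR x (ha.trans_le hx.1))
    refine hint.congr_fun (fun x hx => ?_) (isCompact_closedShell a b).measurableSet
    simp [hχ1 x hx.1 (hx.2.trans (le_max_left _ _))]
  · have hz : ∀ x, x ∉ Ω → φ x = 0 := fun x hx =>
      image_eq_zero_of_notMem_tsupport fun h => hx ((htest φ hφ).2.2 h)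
    have hz' : ∀ x, x ∉ Ω → Laplacian.laplacian φ x = 0 := fun x hx =>
      laplacian_eq_zero_of_notMem_tsupport fun h => hx ((htest φ hφ).2.2 h)
    have h := (hineq φ (htest φ hφ) hφ0).2
    rw [hug.integral_inner_gradient hu2 hg2 (htest φ hφ),
      setIntegral_eq_integral_of_forall_compl_eq_zero fun x hx => by rw [hz x hx, mul_zero],
      setIntegral_eq_integral_of_forall_compl_eq_zero fun x hx => by rw [hz' x hx, mul_zero]] at h
    exact h

end WeakFormulation

namespace IsExteriorDistributionalSupersolution

open MeasureTheory

variable {n : ℕ} {R : ℝ} {u G : EuclideanSpace ℝ (Fin n) → ℝ}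

/-- The defining inequality, tested with a translate of a kernel. -/
theorem integral_kernel_le (h : IsExteriorDistributionalSupersolution R u G)
    {k : EuclideanSpace ℝ (Fin n) → ℝ} (hk : ContDiff ℝ ∞ k) (hk0 : ∀ z, 0 ≤ k z) {r : ℝ}
    (hks : tsupport k ⊆ Metric.closedBall 0 r) {x : EuclideanSpace ℝ (Fin n)}
    (hx : Metric.closedBall x r ⊆ {x : EuclideanSpace ℝ (Fin n) | R < ‖x‖}) :
    ∫ y, G y * k (x - y) ≤ -∫ y, u y * Laplacian.laplacian k (x - y) := by
  have hs : tsupport (fun y => k (x - y)) ⊆ Metric.closedBall x r := by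
    refine closure_minimal (fun y hy => ?_) Metric.isClosed_closedBall
    have : x - y ∈ Metric.closedBall (0 : EuclideanSpace ℝ (Fin n)) r := hks (subset_tsupport _ hy)
    rw [Metric.mem_closedBall, dist_eq_norm, norm_sub_rev]
    simpa using this
  have := h.integral_le (fun y => k (x - y)) ⟨hk.comp (contDiff_const.sub contDiff_id),
    (isCompact_closedBall x r).of_isClosed_subset (isClosed_tsupport _) hs, hs.trans hx⟩
    fun y => hk0 _
  simp_rw [laplacian_comp_const_sub hk] at this
  exact this

/-- Mollifications of distributional supersolutions are classical supersolutions. -/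
theorem laplacian_convolution_le (h : IsExteriorDistributionalSupersolution R u G) {a b : ℝ}
    (ha : R < a) {γ : EuclideanSpace ℝ (Fin n) → ℝ} (hγ : IntegrableOn γ (closedShell n a b))
    (hγG : ∀ᵐ x, x ∈ closedShell n a b → γ x ≤ G x)
    {k : EuclideanSpace ℝ (Fin n) → ℝ} (hk : ContDiff ℝ ∞ k) (hk0 : ∀ z, 0 ≤ k z) {r : ℝ}
    (hks : tsupport k ⊆ Metric.closedBall 0 r) {x : EuclideanSpace ℝ (Fin n)}
    (hx : Metric.closedBall x r ⊆ closedShell n a b) :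
    Laplacian.laplacian (convolution k ((closedShell n a b).indicator u)
      (ContinuousLinearMap.lsmul ℝ ℝ) volume) x ≤
      -convolution k ((closedShell n a b).indicator γ) (ContinuousLinearMap.lsmul ℝ ℝ) volume x := by
  set S := closedShell n a b
  have hSm : MeasurableSet S := (isCompact_closedShell a b).measurableSet
  have hkc : HasCompactSupport k :=
    (isCompact_closedBall 0 r).of_isClosed_subset (isClosed_tsupport _) hks
  -- The kernel centred at x does not reach outside S, so truncating u and γ to S changes none of
  -- the integrals.
  have hout : ∀ y, y ∉ S → x - y ∉ tsupport k := fun y hy hmem => hy (hx (by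
    rw [Metric.mem_closedBall, dist_eq_norm, norm_sub_rev]
    simpa using hks hmem))
  have huS : IntegrableOn u S := h.integrableOn_left a b ha
  have hGS : IntegrableOn G S := h.integrableOn_right a b ha
  rw [laplacian_convolution hk hkc (huS.integrable_indicator hSm).locallyIntegrable, convolution_eq_swap]
  simp_rw [laplacian_comp_const_sub hk]
  have e1 : ∀ y, Laplacian.laplacian k (x - y) * S.indicator u y =
      u y * Laplacian.laplacian k (x - y) := fun y => by
    by_cases hy : y ∈ S
    · rw [Set.indicator_of_mem hy, mul_comm]
    · simp [laplacian_eq_zero_of_notMem_tsupport (hout y hy)]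
  simp_rw [e1]
  have hker := h.integral_kernel_le hk hk0 hks (hx.trans fun y hy => ha.trans_le hy.1)
  have e2 : ∀ w : EuclideanSpace ℝ (Fin n) → ℝ, ∀ y, k (x - y) * S.indicator w y = w y * k (x - y) :=
    fun w y => by
    by_cases hy : y ∈ S
    · rw [Set.indicator_of_mem hy, mul_comm]
    · simp [image_eq_zero_of_notMem_tsupport (hout y hy)]
  have hkcont : Continuous fun y => k (x - y) := hk.continuous.comp (continuous_const.sub continuous_id)
  have hint : ∀ w : EuclideanSpace ℝ (Fin n) → ℝ, IntegrableOn w S →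
      Integrable fun y => w y * k (x - y) := fun w hw => by
    have := (hw.mul_continuousOn hkcont.continuousOn (isCompact_closedShell a b))
    rw [← integrable_indicator_iff hSm] at this
    refine this.congr (Filter.Eventually.of_forall fun y => ?_)
    by_cases hy : y ∈ S
    · simp [hy]
    · simp [hy, image_eq_zero_of_notMem_tsupport (hout y hy)]
  have hmono : ∫ y, γ y * k (x - y) ≤ ∫ y, G y * k (x - y) := by
    refine integral_mono_ae (hint γ hγ) (hint G hGS) ?_
    filter_upwards [hγG] with y hy
    by_cases hyS : y ∈ S
    · exact mul_le_mul_of_nonneg_right (hy hyS) (hk0 _)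
    · simp [image_eq_zero_of_notMem_tsupport (hout y hyS)]
  simp only [ContinuousLinearMap.lsmul_apply, smul_eq_mul]
  simp_rw [e2]
  linarith

end IsExteriorDistributionalSupersolution

/-! ### Almost everywhere comparison for distributional supersolutions. -/

section

open MeasureTheory

variable {n : ℕ}

/-- Bump functions of radius tending to `0`. -/
theorem exists_contDiffBump_sequence {r : ℝ} (hr : 0 < r) :
    ∃ ρ : ℕ → ContDiffBump (0 : EuclideanSpace ℝ (Fin n)), (∀ i, (ρ i).rOut ≤ r) ∧
      ∀ v : EuclideanSpace ℝ (Fin n) → ℝ, LocallyIntegrable v volume → ∀ᵐ x,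
        Filter.Tendsto (fun i => convolution ((ρ i).normed volume) v
          (ContinuousLinearMap.lsmul ℝ ℝ) volume x) Filter.atTop (𝓝 (v x)) := by
  let ρ : ℕ → ContDiffBump (0 : EuclideanSpace ℝ (Fin n)) := fun i =>
    { rIn := r / 2 * (1 / ((i : ℝ) + 1))
      rOut := r * (1 / ((i : ℝ) + 1))
      rIn_pos := mul_pos (half_pos hr) Nat.one_div_pos_of_nat
      rIn_lt_rOut := mul_lt_mul_of_pos_right (half_lt_self hr) Nat.one_div_pos_of_nat }
  refine ⟨ρ, fun i => ?_, fun v hv => ?_⟩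
  · have : 1 / ((i : ℝ) + 1) ≤ 1 := by
      rw [div_le_one (by positivity)]
      linarith [Nat.cast_nonneg (α := ℝ) i]
    calc r * (1 / ((i : ℝ) + 1)) ≤ r * 1 := by gcongr
      _ = r := mul_one r
  · refine ContDiffBump.ae_convolution_tendsto_right_of_locallyIntegrable (K := 2) ?_
      (Filter.Eventually.of_forall fun i => ?_) hv
    · have := (tendsto_one_div_add_atTop_nhds_zero_nat (𝕜 := ℝ)).const_mul r
      rwa [mul_zero] at this
    · change r * (1 / ((i : ℝ) + 1)) ≤ 2 * (r / 2 * (1 / ((i : ℝ) + 1)))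
      linarith

theorem ContDiffBump.convolution_normed_nonneg (ρ : ContDiffBump (0 : EuclideanSpace ℝ (Fin n)))
    {v : EuclideanSpace ℝ (Fin n) → ℝ} (hv : ∀ᵐ x, 0 ≤ v x) (x : EuclideanSpace ℝ (Fin n)) :
    0 ≤ convolution (ρ.normed volume) v (ContinuousLinearMap.lsmul ℝ ℝ) volume x := by
  rw [convolution_eq_swap]
  refine integral_nonneg_of_ae ?_
  filter_upwards [hv] with y hy
  exact mul_nonneg (ρ.nonneg_normed _) hy

/-- Averages against a kernel of mass one preserve upper bounds; this gives a domination uniform in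
the mollification. -/
theorem ContDiffBump.convolution_normed_le (ρ : ContDiffBump (0 : EuclideanSpace ℝ (Fin n)))
    {v : EuclideanSpace ℝ (Fin n) → ℝ} (hv : LocallyIntegrable v volume) {C : ℝ}
    (hvC : ∀ᵐ x, v x ≤ C) (x : EuclideanSpace ℝ (Fin n)) :
    convolution (ρ.normed volume) v (ContinuousLinearMap.lsmul ℝ ℝ) volume x ≤ C := by
  have hc : Continuous (ρ.normed (volume : Measure (EuclideanSpace ℝ (Fin n)))) := ρ.continuous_normed
  have h1 := (ρ.hasCompactSupport_normed (μ := volume)).convolutionExists_left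
    (ContinuousLinearMap.lsmul ℝ ℝ) hc hv x
  have h2 := (ρ.hasCompactSupport_normed (μ := volume)).convolutionExists_left
    (ContinuousLinearMap.lsmul ℝ ℝ) hc (locallyIntegrable_const (μ := volume) C) x
  have h3 : ∫ y, ρ.normed volume (x - y) = 1 := by
    rw [integral_sub_left_eq_self, ρ.integral_normed]
  rw [convolution_eq_swap]
  calc ∫ y, ρ.normed volume (x - y) * v y ≤ ∫ y, ρ.normed volume (x - y) * C := by
        refine integral_mono_ae h1.integrable_swap h2.integrable_swap ?_
        filter_upwards [hvC] with y hy
        exact mul_le_mul_of_nonneg_left hy (ρ.nonneg_normed _)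
    _ = C := by rw [integral_mul_const, h3, one_mul]

/-- Nonnegative distributional supersolutions satisfy the almost everywhere comparison principle. -/
theorem IsExteriorDistributionalSupersolution.comparisonPrinciple (hn : 0 < n) {R : ℝ} (hR : 0 < R)
    {f : ℝ → ℝ} {u : EuclideanSpace ℝ (Fin n) → ℝ}
    (h : IsExteriorDistributionalSupersolution R u fun x => f (u x))
    (hu0 : ∀ᵐ x : EuclideanSpace ℝ (Fin n), R < ‖x‖ → 0 ≤ u x)
    (hf0 : ∀ᵐ x : EuclideanSpace ℝ (Fin n), R < ‖x‖ → 0 ≤ f (u x)) :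
    ComparisonPrinciple (ae volume) f u R := by
  intro a b η φ ha hη hφ hbd hsub
  -- If the two collars overlap they cover the annulus, and the boundary hypothesis is already the
  -- conclusion.
  rcases lt_or_ge (b - η) (a + η) with hab | hab
  · filter_upwards [hbd] with x hx h1 h2
    exact hx h1 h2 ((lt_or_ge ‖x‖ (a + η)).imp_right fun h3 => hab.trans_le h3)
  have ha0 : 0 < a := hR.trans ha
  set S := closedShell n a b with hS
  have hSc : IsCompact S := isCompact_closedShell a b
  have hSm : MeasurableSet S := hSc.measurableSet
  have hφ2 := contDiff_infty.1 hφ 2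
  obtain ⟨M, hM⟩ := hSc.exists_bound_of_continuousOn hφ.continuous.continuousOn
  obtain ⟨N, hN⟩ := hSc.exists_bound_of_continuousOn hφ2.continuous_laplacian.continuousOn
  obtain ⟨χ, hχ, hχ0, hχ1, hχs⟩ := exists_radial_cutoff (n := n) (a₁ := a + η / 4)
    (a₂ := a + η / 2) (b₁ := b - η / 4) (b₂ := b - η / 2) (by linarith) (by linarith) (by linarith)
    (by linarith)
  -- the test function
  set ψ : EuclideanSpace ℝ (Fin n) → ℝ := fun x => χ x * (b ^ 2 - ‖x‖ ^ 2) with hψdef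
  have hψ : ContDiff ℝ ∞ ψ := hχ.mul (contDiff_const.sub (contDiff_norm_sq ℝ))
  have hψs : tsupport ψ ⊆ closedShell n (a + η / 4) (b - η / 4) :=
    (tsupport_mul_subset_left).trans hχs
  have hψc : HasCompactSupport ψ :=
    (isCompact_closedShell _ _).of_isClosed_subset (isClosed_tsupport _) hψs
  have hψ2 := contDiff_infty.1 hψ 2
  have hψout : ∀ x, x ∉ closedShell n (a + η / 4) (b - η / 4) → ψ x = 0 := fun x hx =>
    image_eq_zero_of_notMem_tsupport fun h => hx (hψs h)
  have hψlout : ∀ x, x ∉ closedShell n (a + η / 4) (b - η / 4) → Laplacian.laplacian ψ x = 0 :=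
    fun x hx => laplacian_eq_zero_of_notMem_tsupport fun h => hx (hψs h)
  have hψ0 : ∀ x, 0 ≤ ψ x := fun x => by
    by_cases hx : x ∈ closedShell n (a + η / 4) (b - η / 4)
    · refine mul_nonneg (hχ0 x) ?_
      have := hx.2
      nlinarith [norm_nonneg x]
    · rw [hψout x hx]
  -- Between the collars Δψ = −2n < 0. In the collars the sign of Δψ is unknown but irrelevant,
  -- because u ≥ φ makes the truncation vanish there.
  have hψl : ∀ x, a + η ≤ ‖x‖ → ‖x‖ ≤ b - η → Laplacian.laplacian ψ x = -(2 * n) := fun x h1 h2 => by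
    have hev : ψ =ᶠ[𝓝 x] fun y => b ^ 2 - ‖y‖ ^ 2 := by
      have e1 := continuous_norm.continuousAt.eventually
        (lt_mem_nhds (show a + η / 2 < ‖x‖ by linarith))
      have e2 := continuous_norm.continuousAt.eventually
        (gt_mem_nhds (show ‖x‖ < b - η / 2 by linarith))
      filter_upwards [e1, e2] with y h3 h4
      simp [hψdef, hχ1 y h3.le h4.le]
    rw [(InnerProductSpace.laplacian_congr_nhds hev).eq_of_nhds,
      laplacian_comp_norm_sq (h := fun s => b ^ 2 - s) (h' := fun _ => -1) (h'' := 0)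
        (by fun_prop) (Filter.Eventually.of_forall fun s => by
          simpa using (hasDerivAt_id s).const_sub (b ^ 2)) (hasDerivAt_const _ _)]
    ring
  -- mollification
  set v := S.indicator u with hvdef
  -- N bounds |Δφ| on S. Cutting f(u) at N keeps it at least −Δφ wherever f(u) was, and makes the
  -- mollified right-hand sides bounded.
  set γ := S.indicator (fun x => min (f (u x)) N) with hγdef
  have huS : IntegrableOn u S := h.integrableOn_left a b ha
  have hγS : IntegrableOn (fun x => min (f (u x)) N) S :=
    (h.integrableOn_right a b ha).inf (integrableOn_const hSc.measure_ne_top)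
  have hvint : Integrable v := huS.integrable_indicator hSm
  have hγint : Integrable γ := hγS.integrable_indicator hSm
  have hN0 : ∀ x ∈ S, 0 ≤ N := fun x hx => (norm_nonneg _).trans (hN x hx)
  have hv0 : ∀ᵐ x, 0 ≤ v x := by
    filter_upwards [hu0] with x hx
    exact Set.indicator_apply_nonneg fun hxS => hx (ha.trans_le hxS.1)
  have hγ0 : ∀ᵐ x, 0 ≤ γ x := by
    filter_upwards [hf0] with x hx
    exact Set.indicator_apply_nonneg fun hxS => le_min (hx (ha.trans_le hxS.1)) (hN0 x hxS)
  have hγN : ∀ᵐ x, γ x ≤ |N| := Filter.Eventually.of_forall fun x =>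
    Set.indicator_apply_le' (fun _ => (min_le_right _ _).trans (le_abs_self N)) fun _ => abs_nonneg N
  obtain ⟨ρ, hρr, hρt⟩ := exists_contDiffBump_sequence (n := n) (show 0 < η / 4 by linarith)
  set V : ℕ → EuclideanSpace ℝ (Fin n) → ℝ := fun i =>
    convolution ((ρ i).normed volume) v (ContinuousLinearMap.lsmul ℝ ℝ) volume with hV
  set Γ : ℕ → EuclideanSpace ℝ (Fin n) → ℝ := fun i =>
    convolution ((ρ i).normed volume) γ (ContinuousLinearMap.lsmul ℝ ℝ) volume with hΓ
  have hVt : ∀ᵐ x, Filter.Tendsto (fun i => V i x) Filter.atTop (𝓝 (v x)) :=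
    hρt v hvint.locallyIntegrable
  have hΓt : ∀ᵐ x, Filter.Tendsto (fun i => Γ i x) Filter.atTop (𝓝 (γ x)) :=
    hρt γ hγint.locallyIntegrable
  have hV0 : ∀ i x, 0 ≤ V i x := fun i x => (ρ i).convolution_normed_nonneg hv0 x
  have hΓ0 : ∀ i x, 0 ≤ Γ i x := fun i x => (ρ i).convolution_normed_nonneg hγ0 x
  have hΓN : ∀ i x, Γ i x ≤ |N| := fun i x =>
    (ρ i).convolution_normed_le hγint.locallyIntegrable hγN x
  have hVc : ∀ i, ContDiff ℝ 2 (V i) := fun i =>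
    (ρ i).hasCompactSupport_normed.contDiff_convolution_left _ (n := 2)
      (ρ i).contDiff_normed hvint.locallyIntegrable
  have hΓc : ∀ i, Continuous (Γ i) := fun i =>
    (ρ i).hasCompactSupport_normed.continuous_convolution_left _
      (ρ i).continuous_normed hγint.locallyIntegrable
  have hVl : ∀ i, ∀ x ∈ closedShell n (a + η / 4) (b - η / 4),
      Laplacian.laplacian (V i) x ≤ -Γ i x := fun i x hx => by
    refine h.laplacian_convolution_le ha hγS (Filter.Eventually.of_forall fun x _ => min_le_left _ _)
      (ρ i).contDiff_normed (ρ i).nonneg_normed (r := η / 4) ?_ fun y hy => ?_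
    · rw [(ρ i).tsupport_normed_eq]
      exact Metric.closedBall_subset_closedBall (hρr i)
    · rw [Metric.mem_closedBall, dist_eq_norm] at hy
      have h1 := norm_sub_norm_le y x
      have h2 := norm_sub_norm_le x y
      rw [norm_sub_rev] at h2
      exact ⟨by linarith [hx.1], by linarith [hx.2]⟩
  -- the convex truncation
  set H : ℝ → ℝ := fun s => max (-s) 0 ^ 3 with hH
  set H' : ℝ → ℝ := fun s => -(3 * max (-s) 0 ^ 2) with hH'
  have hHd : ∀ s, HasDerivAt H (H' s) s := fun s => by
    refine (hasDerivAt_max_neg_zero_pow 1 s).congr_deriv ?_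
    norm_num [hH']
  have hHd' : ∀ s, HasDerivAt H' (6 * max (-s) 0) s := fun s => by
    refine ((hasDerivAt_max_neg_zero_pow 0 s).const_mul (-3)).congr_deriv ?_ |>.congr_of_eventuallyEq ?_
    · norm_num
      ring
    · exact Filter.Eventually.of_forall fun t => by simp [hH']
  have hHcont : Continuous H := by fun_prop
  have hHcont' : Continuous H' := by fun_prop
  -- Nonnegativity of u, inherited by its mollifications, bounds the negative part of V − φ by |M|
  -- uniformly; this dominates both limits below.
  have hmaxM : ∀ x ∈ S, ∀ t, 0 ≤ t → max (-(t - φ x)) 0 ≤ |M| := fun x hx t ht => by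
    have h1 : φ x ≤ M := (le_abs_self _).trans (hM x hx)
    exact max_le (by linarith [le_abs_self M]) (abs_nonneg M)
  have hsubS : closedShell n (a + η / 4) (b - η / 4) ⊆ S := fun x hx =>
    ⟨by linarith [hx.1], by linarith [hx.2]⟩
  -- With w = V − φ, convexity gives ΔH(w) ≥ H'(w)Δw. Since H' ≤ 0 and ΔV ≤ −Γ, the right side is at
  -- least 3 max(−w, 0)²(Γ + Δφ), and Green's identity moves the Laplacian from H(w) to ψ.
  have hineq : ∀ i, ∫ x, 3 * max (-(V i x - φ x)) 0 ^ 2 * (Γ i x + Laplacian.laplacian φ x) * ψ x ≤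
      ∫ x, H (V i x - φ x) * Laplacian.laplacian ψ x := fun i => by
    have hwc : ContDiff ℝ 2 fun x => V i x - φ x := (hVc i).sub hφ2
    have hHw : ContDiff ℝ 2 fun x => H (V i x - φ x) := contDiff_max_neg_zero_cubed.comp hwc
    rw [integral_mul_laplacian_eq hHw hψ hψc]
    refine integral_mono ?_ ?_ fun x => ?_
    · refine Continuous.integrable_of_hasCompactSupport ?_ hψc.mul_left
      have := hφ2.continuous_laplacian
      have := (hVc i).continuous
      have := hΓc i
      have := hφ.continuous
      have := hψ.continuous
      fun_prop
    · exact (hHw.continuous_laplacian.mul hψ.continuous).integrable_of_hasCompactSupport hψc.mul_left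
    · by_cases hx : x ∈ closedShell n (a + η / 4) (b - η / 4)
      · refine mul_le_mul_of_nonneg_right (le_trans ?_ (le_laplacian_comp contDiff_max_neg_zero_cubed
          hHd hHd' (fun s => by positivity) hwc x)) (hψ0 x)
        have h1 := (hVc i).contDiffAt.laplacian_sub (x := x) hφ2.contDiffAt
        have h2 : Laplacian.laplacian (fun x => V i x - φ x) x =
          Laplacian.laplacian (V i) x - Laplacian.laplacian φ x := h1
        rw [h2]
        have h3 := hVl i x hx
        have h4 : 0 ≤ 3 * max (-(V i x - φ x)) 0 ^ 2 := by positivity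
        simp only [hH']
        nlinarith
      · simp [hψout x hx]
  -- passage to the limit
  have hlim1 : Filter.Tendsto (fun i => ∫ x, H (V i x - φ x) * Laplacian.laplacian ψ x) Filter.atTop
      (𝓝 (∫ x, H (v x - φ x) * Laplacian.laplacian ψ x)) := by
    refine tendsto_integral_of_dominated_convergence
      (fun x => |M| ^ 3 * |Laplacian.laplacian ψ x|) (fun i => ?_) ?_ (fun i => ?_) ?_
    · exact ((hHcont.comp ((hVc i).continuous.sub hφ.continuous)).mul
        hψ2.continuous_laplacian).aestronglyMeasurable
    · exact ((hψ2.continuous_laplacian.integrable_of_hasCompactSupport hψc.laplacian).abs).const_mul _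
    · refine Filter.Eventually.of_forall fun x => ?_
      by_cases hx : x ∈ closedShell n (a + η / 4) (b - η / 4)
      · rw [norm_mul, Real.norm_eq_abs (Laplacian.laplacian ψ x),
          Real.norm_of_nonneg (by positivity : 0 ≤ H (V i x - φ x))]
        have := hmaxM x (hsubS hx) _ (hV0 i x)
        simp only [hH]
        gcongr
      · simp [hψlout x hx]
    · filter_upwards [hVt] with x hx
      exact ((hHcont.tendsto _).comp (hx.sub_const _)).mul_const _
  have hlim2 : Filter.Tendsto
      (fun i => ∫ x, 3 * max (-(V i x - φ x)) 0 ^ 2 * (Γ i x + Laplacian.laplacian φ x) * ψ x)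
      Filter.atTop
      (𝓝 (∫ x, 3 * max (-(v x - φ x)) 0 ^ 2 * (γ x + Laplacian.laplacian φ x) * ψ x)) := by
    refine tendsto_integral_of_dominated_convergence
      (fun x => 3 * |M| ^ 2 * (|N| + |N|) * ψ x) (fun i => ?_) ?_ (fun i => ?_) ?_
    · have := hφ2.continuous_laplacian
      have := (hVc i).continuous
      have := hΓc i
      have := hφ.continuous
      have := hψ.continuous
      exact Continuous.aestronglyMeasurable (by fun_prop)
    · exact (hψ.continuous.integrable_of_hasCompactSupport hψc).const_mul _
    · refine Filter.Eventually.of_forall fun x => ?_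
      by_cases hx : x ∈ closedShell n (a + η / 4) (b - η / 4)
      · rw [norm_mul, norm_mul, Real.norm_of_nonneg (hψ0 x),
          Real.norm_of_nonneg (by positivity : 0 ≤ 3 * max (-(V i x - φ x)) 0 ^ 2)]
        have h1 := hmaxM x (hsubS hx) _ (hV0 i x)
        have h2 : ‖Γ i x + Laplacian.laplacian φ x‖ ≤ |N| + |N| := by
          refine (norm_add_le _ _).trans (add_le_add ?_ ((hN x (hsubS hx)).trans (le_abs_self N)))
          rw [Real.norm_of_nonneg (hΓ0 i x)]
          exact hΓN i x
        have h3 := hψ0 x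
        gcongr
      · simp [hψout x hx]
    · filter_upwards [hVt, hΓt] with x hx hx2
      have hc : Continuous fun s : ℝ => 3 * max (-s) 0 ^ 2 := by fun_prop
      exact (((hc.tendsto _).comp (hx.sub_const _)).mul (hx2.add_const _)).mul_const _
  -- Either u < φ, and then γ + Δφ ≥ 0 by hypothesis, or the squared negative part is zero.
  have hge : 0 ≤ ∫ x, 3 * max (-(v x - φ x)) 0 ^ 2 * (γ x + Laplacian.laplacian φ x) * ψ x := by
    refine integral_nonneg_of_ae ?_
    filter_upwards [hsub] with x hx
    by_cases hxs : x ∈ closedShell n (a + η / 4) (b - η / 4)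
    · refine mul_nonneg ?_ (hψ0 x)
      rcases lt_or_ge (u x) (φ x) with hlt | hlt
      · refine mul_nonneg (by positivity) ?_
        have h1 := hx (by linarith [hxs.1]) (by linarith [hxs.2]) hlt
        have h2 := (neg_le_abs _).trans (hN x (hsubS hxs))
        have h3 : γ x = min (f (u x)) N := Set.indicator_of_mem (hsubS hxs) _
        have h4 : -(Laplacian.laplacian φ x) ≤ γ x := h3 ▸ le_min h1.le h2
        linarith
      · have h3 : v x = u x := Set.indicator_of_mem (hsubS hxs) _
        rw [h3, max_eq_right (by linarith)]
        simp
    · simp [hψout x hxs]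
  have hge2 : 0 ≤ ∫ x, H (v x - φ x) * Laplacian.laplacian ψ x :=
    hge.trans (le_of_tendsto_of_tendsto hlim2 hlim1 (Filter.Eventually.of_forall hineq))
  -- The integral of H(v − φ)Δψ is nonnegative while its integrand is nonpositive, so the integrand
  -- vanishes almost everywhere. Where Δψ = −2n this forces u ≥ φ.
  have hpt : ∀ᵐ x, 0 ≤ -(H (v x - φ x) * Laplacian.laplacian ψ x) := by
    filter_upwards [hbd] with x hx
    by_cases hxs : x ∈ closedShell n (a + η / 4) (b - η / 4)
    · have h3 : v x = u x := Set.indicator_of_mem (hsubS hxs) _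
      by_cases hmid : a + η ≤ ‖x‖ ∧ ‖x‖ ≤ b - η
      · rw [hψl x hmid.1 hmid.2]
        have h5 : 0 ≤ H (v x - φ x) := by positivity
        have h6 : (0 : ℝ) ≤ n := Nat.cast_nonneg n
        nlinarith
      · have h4 : φ x ≤ u x := by
          refine hx (by linarith [hxs.1]) (by linarith [hxs.2]) ?_
          by_contra hcon
          push Not at hcon
          exact hmid hcon
        have h5 : H (v x - φ x) = 0 := by
          simp only [hH]
          rw [h3, max_eq_right (by linarith)]
          simp
        simp [h5]
    · simp [hψlout x hxs]
  have hintH : Integrable fun x => -(H (v x - φ x) * Laplacian.laplacian ψ x) := by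
    refine Integrable.neg ?_
    refine Integrable.mono' (g := fun x => |M| ^ 3 * |Laplacian.laplacian ψ x|)
      (((hψ2.continuous_laplacian.integrable_of_hasCompactSupport hψc.laplacian).abs).const_mul _) ?_ ?_
    · exact (hHcont.comp_aestronglyMeasurable
        (hvint.aestronglyMeasurable.sub hφ.continuous.aestronglyMeasurable)).mul
        hψ2.continuous_laplacian.aestronglyMeasurable
    · filter_upwards [hv0] with x hx0
      by_cases hx : x ∈ closedShell n (a + η / 4) (b - η / 4)
      · rw [norm_mul, Real.norm_eq_abs (Laplacian.laplacian ψ x),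
          Real.norm_of_nonneg (by positivity : 0 ≤ H (v x - φ x))]
        have := hmaxM x (hsubS hx) _ hx0
        simp only [hH]
        gcongr
      · simp [hψlout x hx]
  have hzero : ∫ x, -(H (v x - φ x) * Laplacian.laplacian ψ x) = 0 := by
    refine le_antisymm ?_ (integral_nonneg_of_ae hpt)
    rw [integral_neg]
    linarith
  rw [integral_eq_zero_iff_of_nonneg_ae hpt hintH] at hzero
  filter_upwards [hzero, hbd] with x hx hxbd h1 h2
  by_contra hcon
  push Not at hcon
  have hmid : ¬(‖x‖ < a + η ∨ b - η < ‖x‖) := fun h => (hxbd h1 h2 h).not_gt hcon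
  push Not at hmid
  have h3 : v x = u x := Set.indicator_of_mem (show x ∈ S from ⟨h1.le, h2.le⟩) _
  rw [Pi.zero_apply, hψl x hmid.1 hmid.2, h3] at hx
  have h4 : 0 < H (u x - φ x) := by
    simp only [hH]
    rw [max_eq_left (by linarith)]
    exact pow_pos (by linarith) 3
  have h5 : (0 : ℝ) < n := by exact_mod_cast hn
  nlinarith

end

/-! ### Radial kernels whose derivative in the radius is a Laplacian. -/

section RadialKernel

/-- The profile of a radial mollifier. -/
noncomputable def kernelProfile (t : ℝ) : ℝ := expNegInvGlue (1 - t)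

/-- A primitive of `-kernelProfile / 2`, vanishing on `[1, ∞)`. -/
noncomputable def kernelPrimitive (t : ℝ) : ℝ :=
  ((∫ r in (0 : ℝ)..1, kernelProfile r) - ∫ r in (0 : ℝ)..t, kernelProfile r) / 2

theorem contDiff_kernelProfile : ContDiff ℝ ∞ kernelProfile :=
  expNegInvGlue.contDiff.comp (contDiff_const.sub contDiff_id)

theorem kernelProfile_nonneg (t : ℝ) : 0 ≤ kernelProfile t := expNegInvGlue.nonneg _

theorem kernelProfile_eq_zero {t : ℝ} (ht : 1 ≤ t) : kernelProfile t = 0 :=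
  expNegInvGlue.zero_of_nonpos (by linarith)

theorem kernelProfile_pos {t : ℝ} (ht : t < 1) : 0 < kernelProfile t :=
  expNegInvGlue.pos_of_pos (by linarith)

theorem kernelProfile_le {t : ℝ} (ht : 0 ≤ t) : kernelProfile t ≤ kernelProfile 0 :=
  expNegInvGlue.monotone (by linarith)

theorem hasDerivAt_kernelPrimitive (t : ℝ) :
    HasDerivAt kernelPrimitive (-(kernelProfile t) / 2) t := by
  have h := (contDiff_kernelProfile.continuous.integral_hasStrictDerivAt 0 t).hasDerivAt
  exact (h.const_sub _).div_const 2

theorem contDiff_kernelPrimitive : ContDiff ℝ ∞ kernelPrimitive := by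
  rw [contDiff_infty_iff_deriv]
  refine ⟨fun t => (hasDerivAt_kernelPrimitive t).differentiableAt, ?_⟩
  rw [funext fun t => (hasDerivAt_kernelPrimitive t).deriv]
  exact contDiff_kernelProfile.neg.div_const 2

theorem kernelPrimitive_eq (t : ℝ) : kernelPrimitive t = (∫ r in t..1, kernelProfile r) / 2 := by
  rw [kernelPrimitive, intervalIntegral.integral_interval_sub_left]
  · exact contDiff_kernelProfile.continuous.intervalIntegrable _ _
  · exact contDiff_kernelProfile.continuous.intervalIntegrable _ _

theorem kernelPrimitive_eq_zero {t : ℝ} (ht : 1 ≤ t) : kernelPrimitive t = 0 := by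
  rw [kernelPrimitive_eq, intervalIntegral.integral_symm,
    intervalIntegral.integral_zero_ae (Filter.Eventually.of_forall fun r hr => ?_)]
  · simp
  · rw [Set.uIoc_of_le ht] at hr
    exact kernelProfile_eq_zero hr.1.le

/-- This sign makes the potential an admissible test function for the supersolution inequality. -/
theorem kernelPrimitive_nonneg (t : ℝ) : 0 ≤ kernelPrimitive t := by
  rcases le_total 1 t with ht | ht
  · rw [kernelPrimitive_eq_zero ht]
  · rw [kernelPrimitive_eq]
    exact div_nonneg (intervalIntegral.integral_nonneg ht fun r _ => kernelProfile_nonneg r) zero_le_two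

/-- The radial kernels `s⁻ⁿ b(|z|² / s²)`. -/
noncomputable def radialKernel (n : ℕ) (s : ℝ) (z : EuclideanSpace ℝ (Fin n)) : ℝ :=
  (s ^ n)⁻¹ * kernelProfile (‖z‖ ^ 2 / s ^ 2)

/-- The compactly supported potential whose Laplacian is the derivative of `radialKernel` in `s`. -/
noncomputable def radialPotential (n : ℕ) (s : ℝ) (z : EuclideanSpace ℝ (Fin n)) : ℝ :=
  s * (s ^ n)⁻¹ * kernelPrimitive (‖z‖ ^ 2 / s ^ 2)

variable {n : ℕ}

theorem contDiff_radialKernel (s : ℝ) : ContDiff ℝ ∞ (radialKernel n s) :=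
  contDiff_const.mul (contDiff_kernelProfile.comp ((contDiff_norm_sq ℝ).div_const _))

theorem contDiff_radialPotential (s : ℝ) : ContDiff ℝ ∞ (radialPotential n s) :=
  contDiff_const.mul (contDiff_kernelPrimitive.comp ((contDiff_norm_sq ℝ).div_const _))

theorem one_le_norm_sq_div {s : ℝ} (hs : 0 < s) {z : EuclideanSpace ℝ (Fin n)} (hz : s ≤ ‖z‖) :
    1 ≤ ‖z‖ ^ 2 / s ^ 2 := by
  rw [one_le_div (by positivity)]
  gcongr

theorem support_radialKernel_subset {s : ℝ} (hs : 0 < s) :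
    Function.support (radialKernel n s) ⊆ Metric.closedBall 0 s := fun z hz => by
  rw [mem_closedBall_zero_iff]
  by_contra hcon
  push Not at hcon
  refine hz ?_
  rw [radialKernel, kernelProfile_eq_zero (one_le_norm_sq_div hs hcon.le), mul_zero]

theorem tsupport_radialPotential_subset {s : ℝ} (hs : 0 < s) :
    tsupport (radialPotential n s) ⊆ Metric.closedBall 0 s := by
  refine closure_minimal (fun z hz => ?_) Metric.isClosed_closedBall
  rw [mem_closedBall_zero_iff]
  by_contra hcon
  push Not at hcon
  refine hz ?_
  rw [radialPotential, kernelPrimitive_eq_zero (one_le_norm_sq_div hs hcon.le), mul_zero]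

theorem hasCompactSupport_radialKernel {s : ℝ} (hs : 0 < s) :
    HasCompactSupport (radialKernel n s) :=
  (isCompact_closedBall 0 s).of_isClosed_subset (isClosed_tsupport _)
    (closure_minimal (support_radialKernel_subset hs) Metric.isClosed_closedBall)

theorem radialKernel_nonneg {s : ℝ} (hs : 0 < s) (z : EuclideanSpace ℝ (Fin n)) :
    0 ≤ radialKernel n s z :=
  mul_nonneg (by positivity) (kernelProfile_nonneg _)

theorem radialKernel_pos {s : ℝ} (hs : 0 < s) {z : EuclideanSpace ℝ (Fin n)} (hz : ‖z‖ < s) :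
    0 < radialKernel n s z := by
  refine mul_pos (by positivity) (kernelProfile_pos ?_)
  rw [div_lt_one (by positivity)]
  gcongr

theorem radialKernel_eq_smul {s : ℝ} (hs : 0 < s) (z : EuclideanSpace ℝ (Fin n)) :
    radialKernel n s z = (s ^ n)⁻¹ * radialKernel n 1 (s⁻¹ • z) := by
  simp only [radialKernel, norm_smul, norm_inv, Real.norm_of_nonneg hs.le]
  simp [mul_pow, div_eq_inv_mul]

theorem integral_radialKernel {s : ℝ} (hs : 0 < s) :
    ∫ z, radialKernel n s z = ∫ z, radialKernel n 1 z := by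
  simp_rw [radialKernel_eq_smul hs]
  rw [MeasureTheory.integral_const_mul, MeasureTheory.Measure.integral_comp_inv_smul,
    finrank_euclideanSpace_fin, abs_of_pos (by positivity), smul_eq_mul]
  field_simp

theorem integral_radialKernel_pos : 0 < ∫ z, radialKernel n 1 z := by
  refine (contDiff_radialKernel 1).continuous.integral_pos_of_hasCompactSupport_nonneg_nonzero
    (hasCompactSupport_radialKernel one_pos) (radialKernel_nonneg one_pos) (x := 0) ?_
  exact (radialKernel_pos one_pos (by simp)).ne'

theorem laplacian_radialPotential {s : ℝ} (hs : 0 < s) (z : EuclideanSpace ℝ (Fin n)) :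
    Laplacian.laplacian (radialPotential n s) z =
      -((n : ℝ) * (s ^ n)⁻¹ * s⁻¹ * kernelProfile (‖z‖ ^ 2 / s ^ 2) +
        2 * ‖z‖ ^ 2 * (s ^ n)⁻¹ * (s ^ 3)⁻¹ * deriv kernelProfile (‖z‖ ^ 2 / s ^ 2)) := by
  have h1 : ∀ t : ℝ, HasDerivAt (fun t => s * (s ^ n)⁻¹ * kernelPrimitive (t / s ^ 2))
      (s * (s ^ n)⁻¹ * (-(kernelProfile (t / s ^ 2)) / 2 * (1 / s ^ 2))) t := fun t =>
    ((hasDerivAt_kernelPrimitive (t / s ^ 2)).comp t ((hasDerivAt_id t).div_const _)).const_mul _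
  have hd : HasDerivAt kernelProfile (deriv kernelProfile (‖z‖ ^ 2 / s ^ 2)) (‖z‖ ^ 2 / s ^ 2) :=
    ((contDiff_kernelProfile.differentiable (by simp)) _).hasDerivAt
  have h2 : HasDerivAt (fun t => s * (s ^ n)⁻¹ * (-(kernelProfile (t / s ^ 2)) / 2 * (1 / s ^ 2)))
      (s * (s ^ n)⁻¹ * (-(deriv kernelProfile (‖z‖ ^ 2 / s ^ 2) * (1 / s ^ 2)) / 2 * (1 / s ^ 2)))
      (‖z‖ ^ 2) :=
    (((hd.comp (‖z‖ ^ 2) ((hasDerivAt_id (‖z‖ ^ 2)).div_const (s ^ 2))).neg.div_const 2).mul_const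
      (1 / s ^ 2)).const_mul _
  have hc : ContDiff ℝ 2 fun t => s * (s ^ n)⁻¹ * kernelPrimitive (t / s ^ 2) :=
    contDiff_const.mul ((contDiff_infty.1 contDiff_kernelPrimitive 2).comp (contDiff_id.div_const _))
  have h3 := laplacian_comp_norm_sq (x := z) hc.contDiffAt (Filter.Eventually.of_forall h1) h2
  refine h3.trans ?_
  field_simp
  ring

/-- With b the profile and B its primitive, B' = −b/2 is chosen so that both sides equal −n s^(−n−1)
b − 2|z|² s^(−n−3) b' at |z|²/s². Monotonicity of radial means thereby reduces to testing with the
nonnegative potential. -/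
theorem hasDerivAt_radialKernel {s : ℝ} (hs : 0 < s) (z : EuclideanSpace ℝ (Fin n)) :
    HasDerivAt (fun s => radialKernel n s z) (Laplacian.laplacian (radialPotential n s) z) s := by
  rw [laplacian_radialPotential hs]
  have hd : HasDerivAt kernelProfile (deriv kernelProfile (‖z‖ ^ 2 / s ^ 2)) (‖z‖ ^ 2 / s ^ 2) :=
    ((contDiff_kernelProfile.differentiable (by simp)) _).hasDerivAt
  have h1 : HasDerivAt (fun s : ℝ => ‖z‖ ^ 2 / s ^ 2) (-(2 * ‖z‖ ^ 2 * (s ^ 3)⁻¹)) s := by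
    refine ((hasDerivAt_const s (‖z‖ ^ 2)).div (hasDerivAt_pow 2 s) (by positivity)).congr_deriv ?_
    field_simp
    ring
  have h2 : HasDerivAt (fun s : ℝ => (s ^ n)⁻¹) (-((n : ℝ) * (s ^ n)⁻¹ * s⁻¹)) s := by
    refine ((hasDerivAt_pow n s).inv (by positivity)).congr_deriv ?_
    rcases n with _ | m
    · simp
    · rw [Nat.add_sub_cancel]
      field_simp
      ring
  refine (h2.mul (hd.comp s h1)).congr_deriv ?_
  simp only [Function.comp]
  ring

open MeasureTheory in
/-- Radial mollifications converge almost everywhere, up to the total mass of the kernel. -/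
theorem ae_tendsto_integral_radialKernel {v : EuclideanSpace ℝ (Fin n) → ℝ}
    (hv : LocallyIntegrable v volume) {s : ℕ → ℝ} (hs : ∀ i, 0 < s i)
    (hs0 : Filter.Tendsto s Filter.atTop (𝓝 0)) :
    ∀ᵐ x, Filter.Tendsto (fun i => ∫ y, radialKernel n (s i) (x - y) * v y) Filter.atTop
      (𝓝 ((∫ z, radialKernel n 1 z) * v x)) := by
  have hs' : Filter.Tendsto s Filter.atTop (𝓝[>] 0) :=
    tendsto_nhdsWithin_iff.2 ⟨hs0, Filter.Eventually.of_forall hs⟩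
  set c := ∫ z : EuclideanSpace ℝ (Fin n), radialKernel n 1 z with hc
  have hc0 : 0 < c := integral_radialKernel_pos
  filter_upwards [(Besicovitch.vitaliFamily volume).ae_tendsto_average_norm_sub hv] with x hx
  have hx' := (hx.comp (Besicovitch.tendsto_filterAt volume x)).comp hs'
  have key : Filter.Tendsto (fun i => ∫ y, (c⁻¹ * radialKernel n (s i) (x - y)) • v y) Filter.atTop
      (𝓝 (v x)) := by
    -- Lebesgue differentiation over balls applies because the normalised kernel is at most c⁻¹
    -- s^(−n) times the profile at 0, which is a constant over the volume of the ball of radius s.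
    refine tendsto_integral_smul_of_tendsto_average_norm_sub
      (c⁻¹ * kernelProfile 0 * volume.real (Metric.ball (0 : EuclideanSpace ℝ (Fin n)) 1)) hx' ?_ ?_ ?_ ?_
    · exact Filter.Eventually.of_forall fun i =>
        hv.integrableOn_isCompact (isCompact_closedBall _ _)
    · refine tendsto_const_nhds.congr fun i => ?_
      rw [integral_const_mul, integral_sub_left_eq_self (radialKernel n (s i)), integral_radialKernel (hs i),
        ← hc, inv_mul_cancel₀ hc0.ne']
    · refine Filter.Eventually.of_forall fun i y hy => ?_
      have h1 : x - y ∈ Function.support (radialKernel n (s i)) := fun h => hy (by simp [h])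
      have h2 := support_radialKernel_subset (hs i) h1
      rw [mem_closedBall_zero_iff] at h2
      rwa [Metric.mem_closedBall, dist_eq_norm, norm_sub_rev]
    · refine Filter.Eventually.of_forall fun i y => ?_
      have hsi := hs i
      have hball : 0 < volume.real (Metric.ball (0 : EuclideanSpace ℝ (Fin n)) 1) :=
        ENNReal.toReal_pos (Metric.measure_ball_pos _ _ one_pos).ne' measure_ball_lt_top.ne
      rw [abs_of_nonneg (mul_nonneg (inv_nonneg.2 hc0.le) (radialKernel_nonneg hsi _)),
        show volume.real ((fun r => Metric.closedBall x r) (s i)) =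
          volume.real (Metric.closedBall x (s i)) from rfl,
        Measure.addHaar_real_closedBall volume x hsi.le, finrank_euclideanSpace_fin,
        mul_div_mul_right _ _ hball.ne', mul_div_assoc]
      refine mul_le_mul_of_nonneg_left ?_ (by positivity)
      rw [radialKernel, div_eq_inv_mul (kernelProfile 0)]
      exact mul_le_mul_of_nonneg_left (kernelProfile_le (by positivity)) (by positivity)
  refine (key.const_mul c).congr fun i => ?_
  rw [← integral_const_mul]
  refine integral_congr_ae (Filter.Eventually.of_forall fun y => ?_)
  simp only [smul_eq_mul]
  field_simp

end RadialKernel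

/-! ### Monotone radial means and a positive lower bound for weak solutions. -/

section

open MeasureTheory

variable {n : ℕ} {R : ℝ} {u G : EuclideanSpace ℝ (Fin n) → ℝ}

theorem closedBall_subset_closedShell {a b r : ℝ} {x : EuclideanSpace ℝ (Fin n)} (ha : a + r ≤ ‖x‖)
    (hb : ‖x‖ ≤ b - r) : Metric.closedBall x r ⊆ closedShell n a b := fun y hy => by
  rw [Metric.mem_closedBall, dist_eq_norm] at hy
  have h1 := norm_sub_norm_le y x
  have h2 := norm_sub_norm_le x y
  rw [norm_sub_rev] at h2
  exact ⟨by linarith, by linarith⟩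

/-- Joint continuity bounds the s-derivative of the kernel uniformly for radii near s and positions
in a compact set, as needed to differentiate under the integral. -/
theorem continuous_laplacian_radialPotential_uncurry :
    ContinuousOn (fun p : ℝ × EuclideanSpace ℝ (Fin n) =>
      Laplacian.laplacian (radialPotential n p.1) p.2) (Set.Ioi 0 ×ˢ Set.univ) := by
  have h1 : ContinuousOn (fun p : ℝ × EuclideanSpace ℝ (Fin n) =>
      -((n : ℝ) * (p.1 ^ n)⁻¹ * p.1⁻¹ * kernelProfile (‖p.2‖ ^ 2 / p.1 ^ 2) +
        2 * ‖p.2‖ ^ 2 * (p.1 ^ n)⁻¹ * (p.1 ^ 3)⁻¹ * deriv kernelProfile (‖p.2‖ ^ 2 / p.1 ^ 2)))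
      (Set.Ioi 0 ×ˢ Set.univ) := by
    have hne : ∀ p ∈ (Set.Ioi (0 : ℝ) ×ˢ (Set.univ : Set (EuclideanSpace ℝ (Fin n)))), p.1 ≠ 0 :=
      fun p hp => (ne_of_gt hp.1)
    have hinv : ∀ m : ℕ, ContinuousOn (fun p : ℝ × EuclideanSpace ℝ (Fin n) => (p.1 ^ m)⁻¹)
        (Set.Ioi 0 ×ˢ Set.univ) := fun m =>
      (continuous_fst.pow m).continuousOn.inv₀ fun p hp => pow_ne_zero _ (hne p hp)
    have hinv1 : ContinuousOn (fun p : ℝ × EuclideanSpace ℝ (Fin n) => p.1⁻¹)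
        (Set.Ioi 0 ×ˢ Set.univ) := continuous_fst.continuousOn.inv₀ hne
    have harg : ContinuousOn (fun p : ℝ × EuclideanSpace ℝ (Fin n) => ‖p.2‖ ^ 2 / p.1 ^ 2)
        (Set.Ioi 0 ×ˢ Set.univ) :=
      (continuous_snd.norm.pow 2).continuousOn.div (continuous_fst.pow 2).continuousOn
        fun p hp => pow_ne_zero _ (hne p hp)
    have hb : Continuous kernelProfile := contDiff_kernelProfile.continuous
    have hb' : Continuous (deriv kernelProfile) := contDiff_kernelProfile.continuous_deriv (by simp)
    have hb1 := hb.comp_continuousOn harg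
    have hb2 := hb'.comp_continuousOn harg
    have hsq : ContinuousOn (fun p : ℝ × EuclideanSpace ℝ (Fin n) => 2 * ‖p.2‖ ^ 2)
        (Set.Ioi 0 ×ˢ Set.univ) := Continuous.continuousOn (by fun_prop)
    exact ((((continuousOn_const.mul (hinv n)).mul hinv1).mul hb1).add
      (((hsq.mul (hinv n)).mul (hinv 3)).mul hb2)).neg
  exact h1.congr fun p hp => laplacian_radialPotential hp.1 p.2

/-- Differentiation of the radial mollifications in the radius. -/
theorem hasDerivAt_integral_radialKernel {S : Set (EuclideanSpace ℝ (Fin n))} (hS : IsCompact S)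
    (hu : IntegrableOn u S) (x : EuclideanSpace ℝ (Fin n)) {s : ℝ} (hs : 0 < s) :
    HasDerivAt (fun s => ∫ y, radialKernel n s (x - y) * S.indicator u y)
      (∫ y, Laplacian.laplacian (radialPotential n s) (x - y) * S.indicator u y) s := by
  have hv : Integrable (S.indicator u) := hu.integrable_indicator hS.measurableSet
  have hcompact : IsCompact (Set.Icc (s / 2) (2 * s) ×ˢ ((fun y => x - y) '' S)) :=
    isCompact_Icc.prod (hS.image (by fun_prop))
  obtain ⟨C, hC⟩ := hcompact.exists_bound_of_continuousOn
    (continuous_laplacian_radialPotential_uncurry.mono (Set.prod_mono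
      (fun t ht => (half_pos hs).trans_le ht.1) (Set.subset_univ _)))
  have hker : ∀ t, 0 < t → Integrable fun y => radialKernel n t (x - y) * S.indicator u y := fun t ht =>
    ((hasCompactSupport_radialKernel ht).convolutionExists_left (ContinuousLinearMap.lsmul ℝ ℝ)
      (contDiff_radialKernel t).continuous hv.locallyIntegrable x).integrable_swap
  have hnhds : Set.Icc (s / 2) (2 * s) ∈ 𝓝 s := Icc_mem_nhds (by linarith) (by linarith)
  refine (hasDerivAt_integral_of_dominated_loc_of_deriv_le (s := Set.Icc (s / 2) (2 * s))
    (F := fun s y => radialKernel n s (x - y) * S.indicator u y)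
    (F' := fun s y => Laplacian.laplacian (radialPotential n s) (x - y) * S.indicator u y)
    (bound := fun y => C * ‖S.indicator u y‖) hnhds ?_ (hker s hs) ?_ ?_
    (hv.norm.const_mul C) ?_).2
  · filter_upwards [lt_mem_nhds hs] with t ht
    exact (hker t ht).aestronglyMeasurable
  · refine AEStronglyMeasurable.mul ?_ hv.aestronglyMeasurable
    have := (contDiff_infty.1 (contDiff_radialPotential (n := n) s) 2).continuous_laplacian
    exact (this.comp (continuous_const.sub continuous_id)).aestronglyMeasurable
  · refine Filter.Eventually.of_forall fun y t ht => ?_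
    by_cases hy : y ∈ S
    · rw [norm_mul]
      exact mul_le_mul_of_nonneg_right (hC (t, x - y) ⟨ht, y, hy, rfl⟩) (norm_nonneg _)
    · simp [hy]
  · refine Filter.Eventually.of_forall fun y t ht => ?_
    exact (hasDerivAt_radialKernel (by linarith [ht.1]) (x - y)).mul_const _

namespace IsExteriorDistributionalSupersolution

/-- Radial means of a superharmonic function decrease in the radius. -/
theorem integral_radialKernel_antitoneOn (h : IsExteriorDistributionalSupersolution R u G)
    (hG : ∀ᵐ x : EuclideanSpace ℝ (Fin n), R < ‖x‖ → 0 ≤ G x) {a b r : ℝ} (ha : R < a)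
    {x : EuclideanSpace ℝ (Fin n)} (hxa : a + r ≤ ‖x‖) (hxb : ‖x‖ ≤ b - r) :
    AntitoneOn (fun s => ∫ y, radialKernel n s (x - y) * (closedShell n a b).indicator u y)
      (Set.Ioo 0 r) := by
  have hd : ∀ s ∈ Set.Ioo 0 r, HasDerivAt
      (fun s => ∫ y, radialKernel n s (x - y) * (closedShell n a b).indicator u y) _ s := fun s hs =>
    hasDerivAt_integral_radialKernel (isCompact_closedShell a b) (h.integrableOn_left a b ha) x hs.1
  refine antitoneOn_of_deriv_nonpos (convex_Ioo 0 r)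
    (fun s hs => (hd s hs).continuousAt.continuousWithinAt)
    (fun s hs => ?_) (fun s hs => ?_)
  · rw [interior_Ioo] at hs
    exact (hd s hs).differentiableAt.differentiableWithinAt
  · rw [interior_Ioo] at hs
    rw [(hd s hs).deriv]
    have hball : Metric.closedBall x s ⊆ closedShell n a b :=
      closedBall_subset_closedShell (by linarith [hs.2]) (by linarith [hs.2])
    have hpot0 : ∀ z, 0 ≤ radialPotential n s z := fun z =>
      mul_nonneg (mul_nonneg hs.1.le (inv_nonneg.2 (pow_nonneg hs.1.le n))) (kernelPrimitive_nonneg _)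
    -- The derivative in s is ∫ u ΔP(x − ·), with P the potential; testing with P bounds it by −∫ G
    -- P(x − ·) ≤ 0.
    have hker := h.integral_kernel_le (contDiff_radialPotential s) hpot0
      (tsupport_radialPotential_subset hs.1) (hball.trans fun y hy => ha.trans_le hy.1)
    have hout : ∀ y, y ∉ closedShell n a b → x - y ∉ tsupport (radialPotential n s) := fun y hy hmem =>
      hy (hball (by
        rw [Metric.mem_closedBall, dist_eq_norm, norm_sub_rev]
        simpa using tsupport_radialPotential_subset hs.1 hmem))
    have e1 : ∀ y, Laplacian.laplacian (radialPotential n s) (x - y) *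
        (closedShell n a b).indicator u y = u y * Laplacian.laplacian (radialPotential n s) (x - y) :=
      fun y => by
      by_cases hy : y ∈ closedShell n a b
      · rw [Set.indicator_of_mem hy, mul_comm]
      · simp [laplacian_eq_zero_of_notMem_tsupport (hout y hy)]
    simp_rw [e1]
    have hG0 : 0 ≤ ∫ y, G y * radialPotential n s (x - y) := by
      refine integral_nonneg_of_ae ?_
      filter_upwards [hG] with y hy
      by_cases hyS : y ∈ closedShell n a b
      · exact mul_nonneg (hy (ha.trans_le hyS.1)) (hpot0 _)
      · simp [image_eq_zero_of_notMem_tsupport (hout y hyS)]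
    linarith

/-- Positive distributional supersolutions are locally bounded below by positive constants. -/
theorem exists_pos_lower_bound (hn : 0 < n) (hR : 0 < R)
    (h : IsExteriorDistributionalSupersolution R u G)
    (hu : ∀ᵐ x : EuclideanSpace ℝ (Fin n), R < ‖x‖ → 0 < u x)
    (hG : ∀ᵐ x : EuclideanSpace ℝ (Fin n), R < ‖x‖ → 0 ≤ G x) :
    ∃ μ, 0 < μ ∧ ∀ᵐ x : EuclideanSpace ℝ (Fin n), 3 * R < ‖x‖ → ‖x‖ < 4 * R → μ ≤ u x := by
  set S := closedShell n (2 * R) (5 * R) with hS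
  have hSm : MeasurableSet S := (isCompact_closedShell _ _).measurableSet
  have hv : Integrable (S.indicator u) :=
    (h.integrableOn_left (2 * R) (5 * R) (by linarith)).integrable_indicator hSm
  set s₀ := R / 2 with hs₀
  have hs₀0 : 0 < s₀ := by positivity
  set F : EuclideanSpace ℝ (Fin n) → ℝ := fun x =>
    ∫ y, radialKernel n s₀ (x - y) * S.indicator u y with hF
  have hexists := (hasCompactSupport_radialKernel hs₀0).convolutionExists_left
      (ContinuousLinearMap.lsmul ℝ ℝ) (contDiff_radialKernel (n := n) s₀).continuous hv.locallyIntegrable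
  have hFc : Continuous F := by
    have := (hasCompactSupport_radialKernel hs₀0).continuous_convolution_left
      (ContinuousLinearMap.lsmul ℝ ℝ) (contDiff_radialKernel (n := n) s₀).continuous hv.locallyIntegrable
    refine this.congr fun x => ?_
    rw [convolution_eq_swap]
    rfl
  have hFpos : ∀ x ∈ closedShell n (3 * R) (4 * R), 0 < F x := fun x hx => by
    have hball : Metric.closedBall x s₀ ⊆ S :=
      closedBall_subset_closedShell (by linarith [hx.1]) (by linarith [hx.2])
    have hnonneg : 0 ≤ᵐ[volume] fun y => radialKernel n s₀ (x - y) * S.indicator u y := by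
      filter_upwards [hu] with y hy
      exact mul_nonneg (radialKernel_nonneg hs₀0 _)
        (Set.indicator_apply_nonneg fun hyS => (hy (by linarith [hyS.1])).le)
    rw [hF]
    refine (integral_pos_iff_support_of_nonneg_ae hnonneg (hexists x).integrable_swap).2 ?_
    refine (Metric.measure_ball_pos volume x hs₀0).trans_le (measure_mono_ae ?_)
    filter_upwards [hu] with y hy hyb
    have hyS : y ∈ S := hball (Metric.ball_subset_closedBall hyb)
    refine ne_of_gt (mul_pos (radialKernel_pos hs₀0 ?_) ?_)
    · rw [← dist_eq_norm, dist_comm]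
      exact hyb
    · rw [Set.indicator_of_mem hyS]
      exact hy (by linarith [hyS.1])
  obtain ⟨z, hz⟩ := exists_norm_eq_of_pos hn (show 0 ≤ 3 * R by linarith)
  obtain ⟨x₀, hx₀, hmin⟩ := (isCompact_closedShell (n := n) (3 * R) (4 * R)).exists_isMinOn
    ⟨z, hz.ge, by linarith⟩ hFc.continuousOn
  set c := ∫ z : EuclideanSpace ℝ (Fin n), radialKernel n 1 z with hc
  have hc0 : 0 < c := integral_radialKernel_pos
  -- F is the mean at the fixed radius s₀: continuous and positive, hence bounded below on the
  -- compact shell. As the radius shrinks the means increase and tend to c·u(x) almost everywhere,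
  -- so c·u ≥ F.
  refine ⟨F x₀ / c, div_pos (hFpos x₀ hx₀) hc0, ?_⟩
  have hlim := ae_tendsto_integral_radialKernel hv.locallyIntegrable
    (s := fun i => s₀ * (1 / ((i : ℝ) + 1))) (fun i => mul_pos hs₀0 Nat.one_div_pos_of_nat) (by
      have := (tendsto_one_div_add_atTop_nhds_zero_nat (𝕜 := ℝ)).const_mul s₀
      rwa [mul_zero] at this)
  filter_upwards [hlim] with x hx h1 h2
  have hxS : x ∈ S := ⟨by linarith, by linarith⟩
  rw [Set.indicator_of_mem hxS] at hx
  rw [div_le_iff₀ hc0, mul_comm]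
  refine le_trans (hmin ⟨h1.le, h2.le⟩) (ge_of_tendsto hx (Filter.Eventually.of_forall fun i => ?_))
  have hi : 0 < 1 / ((i : ℝ) + 1) := Nat.one_div_pos_of_nat
  have hi1 : 1 / ((i : ℝ) + 1) ≤ 1 := by
    rw [div_le_one (by positivity)]
    linarith [Nat.cast_nonneg (α := ℝ) i]
  have hle : s₀ * (1 / ((i : ℝ) + 1)) ≤ s₀ := by nlinarith
  exact h.integral_radialKernel_antitoneOn hG (a := 2 * R) (b := 5 * R) (r := R) (by linarith)
    (by linarith) (by linarith) ⟨mul_pos hs₀0 hi, by linarith⟩ ⟨hs₀0, by linarith⟩ hle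

end IsExteriorDistributionalSupersolution

/-- There is no almost everywhere positive weak supersolution in an exterior domain. -/
theorem IsWeakSupersolution.not_positive (hn : 3 ≤ n) {f : ℝ → ℝ} (hf : ∀ s, 0 < s → 0 < f s)
    (hfp : ∀ C : ℝ, ∃ c : ℝ, 0 < c ∧ ∀ s, 0 < s → s ≤ C → c * s ^ ((n : ℝ) / ((n : ℝ) - 2)) ≤ f s)
    {Ω : Set (EuclideanSpace ℝ (Fin n))} (hΩ : IsExteriorDomain Ω)
    (hpos : ∀ᵐ x ∂(volume.restrict Ω), 0 < u x) (hu : IsWeakSupersolution f Ω u) : False := by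
  obtain ⟨R, hR0, hR⟩ := hΩ.exists_radius
  have hd := hu.isExteriorDistributionalSupersolution hR0 hR
  have hu0 : ∀ᵐ x : EuclideanSpace ℝ (Fin n), R < ‖x‖ → 0 < u x := by
    filter_upwards [(ae_restrict_iff' hΩ.1.measurableSet).1 hpos] with x hx h1
    exact hx (hR x h1)
  have hf0 : ∀ᵐ x : EuclideanSpace ℝ (Fin n), R < ‖x‖ → 0 ≤ f (u x) :=
    hu0.mono fun x hx h1 => (hf _ (hx h1)).le
  obtain ⟨μ, hμ, hinit⟩ := hd.exists_pos_lower_bound (by omega) hR0 hu0 hf0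
  refine (hd.comparisonPrinciple (by omega) hR0 (hu0.mono fun x hx h1 => (hx h1).le) hf0).not_positive hn
    hR0 hf hfp hu0 (fun a b ha hab => ?_) (a := 3 * R) (b := 4 * R) (by linarith) (by linarith) hμ hinit
  obtain ⟨y, hy⟩ := exists_norm_eq_of_pos (n := n) (by omega) (show 0 ≤ (a + b) / 2 by linarith)
  rw [frequently_ae_iff]
  refine ((isOpen_lt continuous_const continuous_norm).inter
    (isOpen_lt continuous_norm continuous_const)).measure_ne_zero volume ⟨y, ?_, ?_⟩
  · rw [Set.mem_ofPred_eq, hy]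
    linarith
  · rw [Set.mem_ofPred_eq, hy]
    linarith

end

/-! ### The three nonexistence statements. -/

theorem theorem2p1 (n : ℕ) (hn : 3 ≤ n) (f : ℝ → ℝ)
    (hf_cont : ContinuousOn f (Set.Ioi 0)) (hf_pos : ∀ s : ℝ, 0 < s → 0 < f s)
    (hf_liminf : (0 : EReal) <
      Filter.liminf (fun s : ℝ => ((s ^ (-((n : ℝ) / ((n : ℝ) - 2))) * f s : ℝ) : EReal))
        (𝓝[>] (0 : ℝ)))
    (Ω : Set (EuclideanSpace ℝ (Fin n))) (hΩ : IsExteriorDomain Ω) :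
    (¬ ∃ u : EuclideanSpace ℝ (Fin n) → ℝ,
      (∀ x ∈ Ω, 0 < u x) ∧ IsClassicalSupersolution f Ω u) ∧
    (¬ ∃ u : EuclideanSpace ℝ (Fin n) → ℝ,
      (∀ᵐ x ∂(MeasureTheory.volume.restrict Ω), 0 < u x) ∧ IsWeakSupersolution f Ω u) ∧
    (¬ ∃ u : EuclideanSpace ℝ (Fin n) → ℝ,
      (∀ x ∈ Ω, 0 < u x) ∧ IsViscositySupersolution f Ω u) := by
  have hn' : (3 : ℝ) ≤ n := by exact_mod_cast hn
  have hN : 0 < (n : ℝ) - 2 := by linarith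
  have hfp := exists_rpow_le_of_liminf_pos (p := (n : ℝ) / ((n : ℝ) - 2)) (by positivity) hf_cont hf_pos
    hf_liminf
  refine ⟨?_, ?_, ?_⟩
  · rintro ⟨u, hpos, hu⟩
    exact (hu.isViscositySupersolution hΩ.1).not_positive hn hf_pos hfp hΩ hpos
  · rintro ⟨u, hpos, hu⟩
    exact hu.not_positive hn hf_pos hfp hΩ hpos
  · rintro ⟨u, hpos, hu⟩
    exact hu.not_positive hn hf_pos hfp hΩ hpos
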